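/- Let $(M,g)$ be a smooth Riemannian manifold, where $M$ is finite-dimensional, connected, Hausdorff, second countable and without boundary. Let $U\subset\mathbb{R}^m$ be compact, let $F:M\times\mathbb{R}^m\to TM$ be a $C^1$-map with $F(x,u)\in T_xM$ such that $F_u:=F(\cdot,u)$ is a smooth vector field on $M$ for each $u\in U$, and let $\mathcal{U}$ be the set of all measurable functions $\omega:\mathbb{R}\to\mathbb{R}^m$ with $\omega(t)\in U$ for almost every $t$. Suppose that for all $x\in M$ and $\omega\in\mathcal{U}$ there is a unique (locally absolutely continuous) solution $t\mapsto\varphi(t,x,\omega)$, defined for all $t\in\mathbb{R}$, of $\dot x(t)=F(x(t),\omega(t))$ for almost every $t$, $x(0)=x$. A pair $(K,Q)$ of nonempty subsets of $M$ is called admissible if $K$ is compact and for each $x\in K$ there is $\omega\in\mathcal{U}$ with $\varphi(t,x,\omega)\in Q$ for all $t\ge 0$. For $\tau>0$ a set $\mathcal{S}\subset\mathcal{U}$ is called $(\tau,K,Q)$-spanning if for each $x\in K$ there is $\omega\in\mathcal{S}$ with $\varphi(t,x,\omega)\in Q$ for all $t\in[0,\tau]$. For a continuous function $f:U\to\mathbb{R}$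 put \[ a_\tau(f,K,Q):=\inf\Big\{\sum_{\omega\in\mathcal{S}}e^{\int_0^\tau f(\omega(t))\,dt}\;;\;\mathcal{S}\ (\tau,K,Q)\text{-spanning}\Big\}\in[0,\infty], \qquad P_{inv}(f,K,Q):=\limsup_{\tau\to\infty}\frac1\tau\log a_\tau(f,K,Q). \] \textbf{Theorem.} Let $(K,Q)$ be an admissible pair such that both $K$ and $Q$ have positive and finite Riemannian volume. Then for every continuous $f:U\to\mathbb{R}$ \[ P_{inv}(f,K,Q)\ \ge\ \limsup_{\tau\to\infty}\frac1\tau\left(\inf_{(x,\omega)}\int_0^\tau f(\omega(s))\,ds+\max\Big\{0,\ \inf_{(x,\omega)}\int_0^\tau \operatorname{div}F_{\omega(s)}(\varphi(s,x,\omega))\,ds\Big\}\right), \] where both infima are taken, in $[-\infty,\infty]$, over all $(x,\omega)\in K\times\mathcal{U}$ with $\varphi([0,\tau],x,\omega)\subset Q$, and $\operatorname{div}$ is the divergence with respect to the Riemannian volume. -/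

import Mathlib

open MeasureTheory Filter Set Topology
open scoped Manifold ContDiff ENNReal

noncomputable section

namespace InvPressure

/-! ### Riemannian volume and divergence -/

section Riemannian

variable {d : ℕ} {M : Type*} [TopologicalSpace M] [ChartedSpace (EuclideanSpace ℝ (Fin d)) M]
  [IsManifold (𝓡 d) ∞ M]

/-- A smooth Riemannian metric on the `d`-dimensional manifold `M`. -/
abbrev Metric (d : ℕ) (M : Type*) [TopologicalSpace M]
    [ChartedSpace (EuclideanSpace ℝ (Fin d)) M] [IsManifold (𝓡 d) ∞ M] :=
  Bundle.ContMDiffRiemannianMetric (𝓡 d) ∞ (EuclideanSpace ℝ (Fin d))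
    (fun x : M => TangentSpace (𝓡 d) x)

/-- The `i`-th coordinate vector field `∂ᵢ` of the chart centred at `x`, at the point with
coordinates `u`. -/
def coordVec (x : M) (u : EuclideanSpace ℝ (Fin d)) (i : Fin d) :
    TangentSpace (𝓡 d) ((extChartAt (𝓡 d) x).symm u) :=
  mfderiv 𝓘(ℝ, EuclideanSpace ℝ (Fin d)) (𝓡 d) (extChartAt (𝓡 d) x).symm u
    (EuclideanSpace.single i (1 : ℝ))

/-- The Gram matrix `gᵢⱼ = g(∂ᵢ, ∂ⱼ)` of the metric in the chart centred at `x`. -/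
def gram (g : Metric d M) (x : M) (u : EuclideanSpace ℝ (Fin d)) : Matrix (Fin d) (Fin d) ℝ :=
  Matrix.of fun i j => g.inner ((extChartAt (𝓡 d) x).symm u) (coordVec x u i) (coordVec x u j)

/-- The Riemannian volume density `√det(gᵢⱼ)` in the chart centred at `x`. -/
def density (g : Metric d M) (x : M) (u : EuclideanSpace ℝ (Fin d)) : ℝ :=
  Real.sqrt (gram g x u).det

/-- The Riemannian volume of the domain of the chart centred at `x`, as a measure on `M`
(vanishing outside that domain): the image under the inverse chart of `√det(gᵢⱼ) du`. -/
def chartVolume [MeasurableSpace M] (g : Metric d M) (x : M) : Measure M :=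
  ((volume.restrict (extChartAt (𝓡 d) x).target).withDensity
    fun u => ENNReal.ofReal (density g x u)).map (extChartAt (𝓡 d) x).symm

/-- The Riemannian volume measure: the smallest measure that dominates the Riemannian volume on
each chart domain. As the volumes on two chart domains agree on the overlap, and `M` is covered by
countably many chart domains, it coincides on each chart domain with the volume of that chart. -/
def riemannianVolume [MeasurableSpace M] (g : Metric d M) : Measure M :=
  ⨆ x : M, chartVolume g x

/-- The coordinate representation of a vector field in the chart centred at `x`. -/
def localRep (X : ∀ p : M, TangentSpace (𝓡 d) p) (x : M) (u : EuclideanSpace ℝ (Fin d)) :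
    EuclideanSpace ℝ (Fin d) :=
  mfderiv (𝓡 d) 𝓘(ℝ, EuclideanSpace ℝ (Fin d)) (extChartAt (𝓡 d) x)
    ((extChartAt (𝓡 d) x).symm u) (X ((extChartAt (𝓡 d) x).symm u))

/-- The Riemannian divergence `div X = (1 / √det g) ∑ᵢ ∂ᵢ (√det g Xⁱ)`. -/
def divergence (g : Metric d M) (X : ∀ p : M, TangentSpace (𝓡 d) p) (x : M) : ℝ :=
  (density g x (extChartAt (𝓡 d) x x))⁻¹ *
    LinearMap.trace ℝ (EuclideanSpace ℝ (Fin d))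
      (fderiv ℝ (fun u => density g x u • localRep X x u) (extChartAt (𝓡 d) x x) :
        EuclideanSpace ℝ (Fin d) →ₗ[ℝ] EuclideanSpace ℝ (Fin d))

end Riemannian

/-! ### Control systems -/

section Control

/-- The admissible control functions with control range `U`: the Lebesgue measurable functions
`w : ℝ → ℝᵐ` with `w t ∈ U` for almost every `t`. -/
def Controls {m : ℕ} (U : Set (EuclideanSpace ℝ (Fin m))) : Type :=
  {w : ℝ → EuclideanSpace ℝ (Fin m) // AEMeasurable w volume ∧ ∀ᵐ t, w t ∈ U}

instance {m : ℕ} (U : Set (EuclideanSpace ℝ (Fin m))) :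
    CoeFun (Controls U) (fun _ => ℝ → EuclideanSpace ℝ (Fin m)) :=
  ⟨fun w => w.1⟩

/-- `γ : ℝ → M` is a (Carathéodory) solution of `γ'(t) = F (γ t) (w t)`, `γ 0 = x`: it is
continuous, locally absolutely continuous in charts, and satisfies the equation for almost
every `t`. -/
structure IsTrajectory {d m : ℕ} {M : Type*} [TopologicalSpace M]
    [ChartedSpace (EuclideanSpace ℝ (Fin d)) M]
    (F : ∀ x : M, EuclideanSpace ℝ (Fin m) → TangentSpace (𝓡 d) x)
    (w : ℝ → EuclideanSpace ℝ (Fin m)) (x : M) (γ : ℝ → M) : Prop where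
  init : γ 0 = x
  continuous : Continuous γ
  locallyAC : ∀ t₀ : ℝ, ∃ ε > 0,
    (∀ t ∈ Icc (t₀ - ε) (t₀ + ε), γ t ∈ (extChartAt (𝓡 d) (γ t₀)).source) ∧
    AbsolutelyContinuousOnInterval (fun t => extChartAt (𝓡 d) (γ t₀) (γ t)) (t₀ - ε) (t₀ + ε)
  equation : ∀ᵐ t : ℝ, HasMFDerivAt 𝓘(ℝ, ℝ) (𝓡 d) γ t
    ((1 : ℝ →L[ℝ] ℝ).smulRight (F (γ t) (w t)))

/-- A control system `ẋ = F(x, w)` on the smooth manifold `M` with compact control range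
`U ⊆ ℝᵐ`: the map `F : M × ℝᵐ → TM` is `C¹` with `F (x, u) ∈ TₓM`, each `F (·, u)` with `u ∈ U` is
a smooth vector field, and for each initial point and each admissible control there is a unique
solution defined for all times. -/
structure ControlSystem (d m : ℕ) (M : Type*) [TopologicalSpace M]
    [ChartedSpace (EuclideanSpace ℝ (Fin d)) M] [IsManifold (𝓡 d) ∞ M] where
  /-- the right-hand side -/
  F : ∀ x : M, EuclideanSpace ℝ (Fin m) → TangentSpace (𝓡 d) x
  /-- the control range -/
  U : Set (EuclideanSpace ℝ (Fin m))
  isCompact_U : IsCompact U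
  contMDiff_F : ContMDiff ((𝓡 d).prod 𝓘(ℝ, EuclideanSpace ℝ (Fin m))) (𝓡 d).tangent 1
    (fun p : M × EuclideanSpace ℝ (Fin m) => (⟨p.1, F p.1 p.2⟩ : TangentBundle (𝓡 d) M))
  smooth_F : ∀ u ∈ U, ContMDiff (𝓡 d) (𝓡 d).tangent ∞
    (fun x : M => (⟨x, F x u⟩ : TangentBundle (𝓡 d) M))
  existsUnique_trajectory : ∀ (x : M) (w : Controls U), ∃! γ : ℝ → M, IsTrajectory F w x γ

namespace ControlSystem

variable {d m : ℕ} {M : Type*} [TopologicalSpace M]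
  [ChartedSpace (EuclideanSpace ℝ (Fin d)) M] [IsManifold (𝓡 d) ∞ M]

/-- The trajectory `φ(t, x, w)`. -/
def φ (Sys : ControlSystem d m M) (t : ℝ) (x : M) (w : Controls Sys.U) : M :=
  (Sys.existsUnique_trajectory x w).choose t

/-- The pair `(K, Q)` of nonempty subsets of `M` is admissible: `K` is compact and from each point
of `K` one can stay in `Q` for all nonnegative times. -/
structure Admissible (Sys : ControlSystem d m M) (K Q : Set M) : Prop where
  nonempty_left : K.Nonempty
  nonempty_right : Q.Nonempty
  isCompact : IsCompact K
  exists_control : ∀ x ∈ K, ∃ w : Controls Sys.U, ∀ t : ℝ, 0 ≤ t → Sys.φ t x w ∈ Q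

/-- The set `S` of controls is `(τ, K, Q)`-spanning. -/
def Spanning (Sys : ControlSystem d m M) (τ : ℝ) (K Q : Set M) (S : Set (Controls Sys.U)) : Prop :=
  ∀ x ∈ K, ∃ w ∈ S, ∀ t ∈ Icc 0 τ, Sys.φ t x w ∈ Q

/-- `(S_τ f)(w) = ∫₀^τ f(w(t)) dt`. -/
def potentialSum (Sys : ControlSystem d m M) (f : EuclideanSpace ℝ (Fin m) → ℝ) (τ : ℝ)
    (w : Controls Sys.U) : ℝ :=
  ∫ t in (0 : ℝ)..τ, f (w t)

/-- `a_τ(f, K, Q)`, the infimum of `∑_{w ∈ S} exp ((S_τ f)(w))` over the `(τ, K, Q)`-spanning sets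
`S`, in `[0, ∞]`. -/
def aInv (Sys : ControlSystem d m M) (f : EuclideanSpace ℝ (Fin m) → ℝ) (K Q : Set M) (τ : ℝ) :
    ℝ≥0∞ :=
  ⨅ (S : Set (Controls Sys.U)) (_ : Sys.Spanning τ K Q S),
    ∑' w : S, ENNReal.ofReal (Real.exp (Sys.potentialSum f τ w))

/-- The invariance pressure `P_inv(f, K, Q) = limsup_{τ → ∞} (1/τ) log a_τ(f, K, Q)`. -/
def invariancePressure (Sys : ControlSystem d m M) (f : EuclideanSpace ℝ (Fin m) → ℝ)
    (K Q : Set M) : EReal :=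
  limsup (fun τ : ℝ => ((τ⁻¹ : ℝ) : EReal) * ENNReal.log (Sys.aInv f K Q τ)) atTop

/-- The pairs `(x, w) ∈ K × 𝒰` with `φ([0, τ], x, w) ⊆ Q`. -/
def stayingPairs (Sys : ControlSystem d m M) (K Q : Set M) (τ : ℝ) : Set (M × Controls Sys.U) :=
  {p | p.1 ∈ K ∧ ∀ s ∈ Icc 0 τ, Sys.φ s p.1 p.2 ∈ Q}

/-- `∫₀^τ div F_{w(s)}(φ(s, x, w)) ds`. -/
def divergenceIntegral (Sys : ControlSystem d m M) (g : Metric d M) (τ : ℝ) (x : M)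
    (w : Controls Sys.U) : ℝ :=
  ∫ s in (0 : ℝ)..τ, divergence g (fun p => Sys.F p (w s)) (Sys.φ s x w)

end ControlSystem

end Control

end InvPressure

end

set_option linter.unusedSectionVars false

/-! The heart is a volume count. Let `S` be a spanning set with finite weighted sum; it is then
countable, and `K` is covered by the sets `A w` of those points of `K` which the control `w ∈ S`
keeps in `Q` up to time `τ`. If every staying trajectory has divergence integral at least `β`,
Liouville's formula says that the time-`τ` map of `w` expands the volume of `A w` by at least `exp
β`. Its image lies in `Q`, so `vol (A w) ≤ exp (-β) * vol Q`. If moreover `α` bounds the potential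
sums of the staying pairs from below, multiplying by `exp (α + β)` and summing over `S` gives `vol K
* exp (α + β) ≤ vol Q * ∑ exp (S_τ f w)`; this is `volume_mul_exp_le_of_spanning`. A single term of
the sum already gives `exp α`, which accounts for the `0` in the maximum. After taking logarithms,
the volumes contribute a constant that disappears under `1 / τ`.

Liouville's inequality, `riemannianVolume_image_le`, is proved for merely measurable controls and
arbitrary sets of initial points, without differentiating the flow in the initial value. Near a
point of a chart and over a short time, the difference of two trajectories is carried backward by
the linear map `1 - ∫ D`, up to a small Lipschitz error, where `D` is the state derivative of the
right-hand side frozen at that point (`norm_sub_le_of_integral_eq`). Such a map distorts Lebesgue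
measure by at most about `|det (1 - ∫ D)|` (`volume_image_le_of_approx_linear`), which is about `exp
(-∫ tr D)`. The change of the logarithm of the Riemannian density supplies the rest of the
divergence.

All errors are at most `ε` per unit of time, so the local bounds compose along a compact time
interval (`backwardVolumeBound`). A Lindelöf argument passes from neighbourhoods to whole sets, and
finally `ε → 0`. -/

namespace InvPressure

/-! ### First-order expansion of the determinant. -/

section Determinant

variable {ι : Type*} [Fintype ι] [DecidableEq ι]

lemma Matrix.contDiff_det : ContDiff ℝ ∞ (fun A : ι → ι → ℝ => (Matrix.of A).det) := by
  simp only [Matrix.det_apply]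
  refine ContDiff.sum fun σ _ => ContDiff.const_smul _ (contDiff_prod fun i _ => ?_)
  exact (contDiff_apply_apply ℝ ℝ (σ i) i)

lemma Matrix.hasDerivAt_det_one_add_smul (A : Matrix ι ι ℝ) :
    HasDerivAt (fun r : ℝ => (1 + r • A).det) A.trace 0 := by
  have h1 : (fun r : ℝ => (1 + r • A).det) = fun r => 1 + A.trace * r +
      (Polynomial.divX (Polynomial.divX
        (Matrix.det (1 + (Polynomial.X : Polynomial ℝ) • A.map Polynomial.C)))).eval r * r ^ 2 :=
    funext fun r => Matrix.det_one_add_smul r A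
  rw [h1]
  set p := Polynomial.divX (Polynomial.divX
        (Matrix.det (1 + (Polynomial.X : Polynomial ℝ) • A.map Polynomial.C)))
  have h2 := (((hasDerivAt_id (0 : ℝ)).const_mul A.trace).const_add 1).add
    ((p.hasDerivAt 0).mul ((hasDerivAt_id (0 : ℝ)).pow 2))
  convert! h2 using 1
  simp

variable {E : Type*} [NormedAddCommGroup E] [NormedSpace ℝ E] [FiniteDimensional ℝ E]

lemma clm_det_comp {E : Type*} [NormedAddCommGroup E] [NormedSpace ℝ E] (A B : E →L[ℝ] E) :
    (A.comp B).det = A.det * B.det :=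
  LinearMap.det_comp (A : E →ₗ[ℝ] E) (B : E →ₗ[ℝ] E)

lemma contDiff_clm_det : ContDiff ℝ ∞ (fun T : E →L[ℝ] E => T.det) := by
  classical
  let b := Module.finBasis ℝ E
  have h : (fun T : E →L[ℝ] E => T.det) = fun T =>
      (Matrix.of fun i j => b.coord i (T (b j))).det := by
    funext T
    rw [ContinuousLinearMap.det, ← LinearMap.det_toMatrix b]
    congr 1
    ext i j
    simp [LinearMap.toMatrix_apply]
  rw [h]
  refine Matrix.contDiff_det.comp (contDiff_pi.2 fun i => contDiff_pi.2 fun j => ?_)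
  exact (LinearMap.toContinuousLinearMap (b.coord i)).contDiff.comp
    (ContinuousLinearMap.apply ℝ E (b j)).contDiff

/-- The trace of a continuous linear endomorphism, as a continuous linear functional. -/
noncomputable def traceCLM (E : Type*) [NormedAddCommGroup E] [NormedSpace ℝ E]
    [FiniteDimensional ℝ E] : (E →L[ℝ] E) →L[ℝ] ℝ :=
  LinearMap.toContinuousLinearMap
    ((LinearMap.trace ℝ E).comp (ContinuousLinearMap.coeLM ℝ))

@[simp] lemma traceCLM_apply (T : E →L[ℝ] E) :
    traceCLM E T = LinearMap.trace ℝ E (T : E →ₗ[ℝ] E) := rfl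

/-- Since the determinant is smooth, its derivative at `1` is determined by the lines `1 + r • T`,
where the matrix expansion in powers of `r` applies. -/
lemma hasFDerivAt_clm_det_one :
    HasFDerivAt (fun T : E →L[ℝ] E => T.det) (traceCLM E) (1 : E →L[ℝ] E) := by
  classical
  have hd : DifferentiableAt ℝ (fun T : E →L[ℝ] E => T.det) 1 :=
    (contDiff_clm_det.differentiable (by simp)).differentiableAt
  have h1 := hd.hasFDerivAt
  have : fderiv ℝ (fun T : E →L[ℝ] E => T.det) 1 = traceCLM E := by
    ext T
    have hl : HasDerivAt (fun r : ℝ => (1 : E →L[ℝ] E) + r • T) T 0 := by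
      simpa using ((hasDerivAt_id (0 : ℝ)).smul_const T).const_add (1 : E →L[ℝ] E)
    have h1' : HasFDerivAt (fun T : E →L[ℝ] E => T.det)
        (fderiv ℝ (fun T : E →L[ℝ] E => T.det) 1) ((1 : E →L[ℝ] E) + (0 : ℝ) • T) := by
      simpa using h1
    have h2 := h1'.comp_hasDerivAt (0 : ℝ) hl
    let b := Module.finBasis ℝ E
    have h3 := Matrix.hasDerivAt_det_one_add_smul (LinearMap.toMatrix b b (T : E →ₗ[ℝ] E))
    have h4 : (fun r : ℝ => (1 + r • LinearMap.toMatrix b b (T : E →ₗ[ℝ] E)).det) =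
        (fun T : E →L[ℝ] E => T.det) ∘ fun r : ℝ => (1 : E →L[ℝ] E) + r • T := by
      funext r
      simp only [Function.comp]
      rw [ContinuousLinearMap.det, ← LinearMap.det_toMatrix b]
      congr 1
      rw [← LinearMap.toMatrix_one b]
      rw [← map_smul, ← map_add]
      rfl
    rw [h4] at h3
    rw [traceCLM_apply, LinearMap.trace_eq_matrix_trace ℝ b]
    exact h2.unique h3
  rwa [this] at h1

/-- Jacobi's formula for the derivative of the determinant at an invertible map. -/
lemma hasFDerivAt_clm_det (A : E ≃L[ℝ] E) :
    HasFDerivAt (fun T : E →L[ℝ] E => T.det)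
      ((A : E →L[ℝ] E).det • (traceCLM E).comp
        (ContinuousLinearMap.compL ℝ E E E (A.symm : E →L[ℝ] E))) (A : E →L[ℝ] E) := by
  have h0 : (ContinuousLinearMap.compL ℝ E E E (A.symm : E →L[ℝ] E)) (A : E →L[ℝ] E) = 1 := by
    ext x; simp
  have h1 : HasFDerivAt (fun T : E →L[ℝ] E => T.det) (traceCLM E)
      ((ContinuousLinearMap.compL ℝ E E E (A.symm : E →L[ℝ] E)) (A : E →L[ℝ] E)) := by
    rw [h0]; exact hasFDerivAt_clm_det_one
  have h2 := (h1.comp (A : E →L[ℝ] E)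
    (ContinuousLinearMap.compL ℝ E E E (A.symm : E →L[ℝ] E)).hasFDerivAt).const_smul
      (A : E →L[ℝ] E).det
  refine h2.congr_of_eventuallyEq (Eventually.of_forall fun T => ?_)
  simp only [Pi.smul_apply, Function.comp, ContinuousLinearMap.compL_apply, smul_eq_mul]
  have : T = (A : E →L[ℝ] E).comp ((A.symm : E →L[ℝ] E).comp T) := by ext x; simp
  conv_lhs => rw [this]
  exact clm_det_comp _ _

/-- Near `1` the determinant is positive and equals `1 + tr T` up to `ε * ‖T‖`; then `1 + x ≤ exp
x`. The exponential form lets successive estimates add up in the exponent. -/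
lemma exists_abs_det_one_add_le {ε : ℝ} (hε : 0 < ε) :
    ∃ δ > 0, ∀ T : E →L[ℝ] E, ‖T‖ ≤ δ →
      |(1 + T).det| ≤ Real.exp (LinearMap.trace ℝ E (T : E →ₗ[ℝ] E) + ε * ‖T‖) := by
  have h := (hasFDerivAt_clm_det_one (E := E)).isLittleO
  have h1 := h.def hε
  have hc : ContinuousAt (fun T : E →L[ℝ] E => T.det) 1 :=
    contDiff_clm_det.continuous.continuousAt
  have hpos : ∀ᶠ T : E →L[ℝ] E in 𝓝 1, 0 < T.det :=
    hc.eventually (lt_mem_nhds (by simp [ContinuousLinearMap.det]))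
  obtain ⟨δ, hδ, hball⟩ := Metric.eventually_nhds_iff.1 (h1.and hpos)
  refine ⟨δ / 2, by positivity, fun T hT => ?_⟩
  have hd : dist (1 + T) 1 < δ := by
    rw [dist_eq_norm]; simp only [add_sub_cancel_left]; linarith
  obtain ⟨h2, h3⟩ := hball hd
  simp only [add_sub_cancel_left, traceCLM_apply] at h2
  rw [abs_of_pos h3]
  have h4 := (abs_le.1 (Real.norm_eq_abs _ ▸ h2)).2
  have h5 : (1 : E →L[ℝ] E).det = 1 := by simp [ContinuousLinearMap.det]
  rw [h5] at h4
  calc (1 + T).det ≤ LinearMap.trace ℝ E (T : E →ₗ[ℝ] E) + ε * ‖T‖ + 1 := by linarith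
    _ ≤ _ := Real.add_one_le_exp _

end Determinant

/-! ### Distortion of Lebesgue measure by nearly linear maps. -/

section LipschitzVolume

variable {E : Type*} [NormedAddCommGroup E] [InnerProductSpace ℝ E] [FiniteDimensional ℝ E]
  [MeasurableSpace E] [BorelSpace E]

/-- The hypothesis makes `Z` factor on `A` through a `K`-Lipschitz function of `Y`. Lebesgue measure
is a multiple of the Hausdorff measure of the same dimension, for which the bound holds on
arbitrary, possibly nonmeasurable, sets. Indexing by `ι` allows two times of a family of curves to
be compared without constructing a flow map. -/
lemma volume_image_le_of_lipschitz {ι : Type*} {K : ℝ} (hK : 0 ≤ K) (Y Z : ι → E) (A : Set ι)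
    (h : ∀ i ∈ A, ∀ j ∈ A, ‖Z i - Z j‖ ≤ K * ‖Y i - Y j‖) :
    volume (Z '' A) ≤ ENNReal.ofReal (K ^ Module.finrank ℝ E) * volume (Y '' A) := by
  classical
  have hg : ∀ y : E, ∃ z : E, ∀ i ∈ A, Y i = y → Z i = z := by
    intro y
    by_cases hy : ∃ i ∈ A, Y i = y
    · obtain ⟨i, hi, rfl⟩ := hy
      refine ⟨Z i, fun j hj hji => ?_⟩
      have := h j hj i hi
      rw [hji, sub_self, norm_zero, mul_zero] at this
      exact sub_eq_zero.1 (norm_le_zero_iff.1 this)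
    · exact ⟨0, fun i hi hiy => absurd ⟨i, hi, hiy⟩ hy⟩
  choose g hg using hg
  have himg : Z '' A = g '' (Y '' A) := by
    rw [image_image]
    exact image_congr fun i hi => hg _ i hi rfl
  have hlip : LipschitzOnWith (NNReal.mk K hK) g (Y '' A) := by
    refine LipschitzOnWith.of_dist_le_mul ?_
    rintro _ ⟨i, hi, rfl⟩ _ ⟨j, hj, rfl⟩
    rw [← hg _ i hi rfl, ← hg _ j hj rfl, dist_eq_norm, dist_eq_norm]
    exact h i hi j hj
  have h1 := hlip.hausdorffMeasure_image_le (d := Module.finrank ℝ E) (by positivity)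
  set c := Measure.addHaarScalarFactor (volume : Measure E) μH[Module.finrank ℝ E]
  have h2 : (volume : Measure E) = c • (μH[Module.finrank ℝ E] : Measure E) :=
    Measure.isAddLeftInvariant_eq_smul _ _
  rw [himg, h2]
  simp only [Measure.smul_apply]
  calc c • (μH[Module.finrank ℝ E] : Measure E) (g '' (Y '' A))
      ≤ c • ((NNReal.mk K hK : ℝ≥0∞) ^ ((Module.finrank ℝ E : ℕ) : ℝ)
          * (μH[Module.finrank ℝ E] : Measure E) (Y '' A)) := by gcongr
    _ = _ := by
      rw [ENNReal.rpow_natCast, ENNReal.ofReal_pow hK, ENNReal.smul_def, ENNReal.smul_def,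
        smul_eq_mul, smul_eq_mul]
      have : ENNReal.ofReal K = (NNReal.mk K hK : ℝ≥0∞) := by
        rw [ENNReal.ofReal, Real.toNNReal_of_nonneg hK]
      rw [this]; ring

/-- A map that is close to the linear map `1 + T` distorts volumes by at most about
`|det (1 + T)|`. -/
lemma volume_image_le_of_approx_linear {ι : Type*} (T : E →L[ℝ] E) (hT : ‖T‖ ≤ 1 / 2)
    {c : ℝ} (hc : 0 ≤ c) (Y Z : ι → E) (A : Set ι)
    (h : ∀ i ∈ A, ∀ j ∈ A, ‖Z i - Z j - (1 + T) (Y i - Y j)‖ ≤ c * ‖Y i - Y j‖) :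
    volume (Z '' A) ≤ ENNReal.ofReal
      (|(1 + T).det| * (1 + 2 * c) ^ Module.finrank ℝ E) * volume (Y '' A) := by
  -- The inverse of `1 + T` has norm at most `2`. Applying it to `Z` leaves a perturbation of `Y`
  -- with Lipschitz constant `1 + 2 * c`, while the linear factor contributes exactly its
  -- determinant.
  have hlow : ∀ v : E, ‖v‖ ≤ 2 * ‖(1 + T) v‖ := by
    intro v
    have h1 : ‖T v‖ ≤ 1 / 2 * ‖v‖ := T.le_of_opNorm_le hT v
    have h2 : ‖v‖ ≤ ‖(1 + T) v‖ + ‖T v‖ := by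
      have := norm_sub_le ((1 + T) v) (T v)
      simpa using this
    linarith
  have hinj : Function.Injective ((1 + T : E →L[ℝ] E) : E →ₗ[ℝ] E) := by
    rw [injective_iff_map_eq_zero]
    intro v hv
    have h1 := hlow v
    have hv' : (1 + T) v = 0 := hv
    rw [hv', norm_zero, mul_zero] at h1
    exact norm_le_zero_iff.1 h1
  let e : E ≃ₗ[ℝ] E := LinearEquiv.ofInjectiveEndo _ hinj
  have he : ∀ v, e v = (1 + T) v := fun v => rfl
  have hZ : Z '' A = (1 + T : E →L[ℝ] E) '' ((fun i => e.symm (Z i)) '' A) := by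
    rw [image_image]
    refine image_congr fun i _ => ?_
    rw [← he, e.apply_symm_apply]
  rw [hZ, Measure.addHaar_image_continuousLinearMap, ENNReal.ofReal_mul (abs_nonneg _), mul_assoc]
  gcongr
  refine volume_image_le_of_lipschitz (by positivity) Y _ A fun i hi j hj => ?_
  have h1 := hlow (e.symm (Z i) - e.symm (Z j) - (Y i - Y j))
  have h2 : (1 + T) (e.symm (Z i) - e.symm (Z j) - (Y i - Y j)) =
      Z i - Z j - (1 + T) (Y i - Y j) := by
    rw [map_sub, map_sub, ← he, ← he, e.apply_symm_apply, e.apply_symm_apply]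
  rw [h2] at h1
  have h3 := h i hi j hj
  have h4 : ‖e.symm (Z i) - e.symm (Z j)‖ ≤
      ‖e.symm (Z i) - e.symm (Z j) - (Y i - Y j)‖ + ‖Y i - Y j‖ := by
    simpa using norm_add_le (e.symm (Z i) - e.symm (Z j) - (Y i - Y j)) (Y i - Y j)
  linarith

end LipschitzVolume

/-! ### Regularity of the metric and of vector fields in chart coordinates. -/

section Charts

variable {d : ℕ} {M : Type*} [TopologicalSpace M] [ChartedSpace (EuclideanSpace ℝ (Fin d)) M]
  [IsManifold (𝓡 d) ∞ M]

lemma extChartAt_symm_mem_chart_source {p : M} {u : EuclideanSpace ℝ (Fin d)}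
    (hu : u ∈ (extChartAt (𝓡 d) p).target) :
    (extChartAt (𝓡 d) p).symm u ∈ (chartAt (EuclideanSpace ℝ (Fin d)) p).source := by
  rw [← extChartAt_source (𝓡 d)]
  exact (extChartAt (𝓡 d) p).map_target hu

lemma mfderiv_extChartAt_comp_symm {p : M} {u : EuclideanSpace ℝ (Fin d)}
    (hu : u ∈ (extChartAt (𝓡 d) p).target) :
    (mfderiv (𝓡 d) 𝓘(ℝ, EuclideanSpace ℝ (Fin d)) (extChartAt (𝓡 d) p)
      ((extChartAt (𝓡 d) p).symm u)).comp
      (mfderiv 𝓘(ℝ, EuclideanSpace ℝ (Fin d)) (𝓡 d) (extChartAt (𝓡 d) p).symm u) =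
      ContinuousLinearMap.id ℝ _ := by
  have := mfderiv_extChartAt_comp_mfderivWithin_extChartAt_symm (I := 𝓡 d) hu
  rwa [ModelWithCorners.range_eq_univ, mfderivWithin_univ] at this

lemma mfderiv_symm_comp_extChartAt {p : M} {u : EuclideanSpace ℝ (Fin d)}
    (hu : u ∈ (extChartAt (𝓡 d) p).target) :
    (mfderiv 𝓘(ℝ, EuclideanSpace ℝ (Fin d)) (𝓡 d) (extChartAt (𝓡 d) p).symm u).comp
      (mfderiv (𝓡 d) 𝓘(ℝ, EuclideanSpace ℝ (Fin d)) (extChartAt (𝓡 d) p)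
      ((extChartAt (𝓡 d) p).symm u)) =
      ContinuousLinearMap.id ℝ _ := by
  have := mfderivWithin_extChartAt_symm_comp_mfderiv_extChartAt (I := 𝓡 d) hu
  rwa [ModelWithCorners.range_eq_univ, mfderivWithin_univ] at this

lemma mfderiv_extChartAt_symm_injective {p : M} {u : EuclideanSpace ℝ (Fin d)}
    (hu : u ∈ (extChartAt (𝓡 d) p).target) :
    Function.Injective
      (mfderiv 𝓘(ℝ, EuclideanSpace ℝ (Fin d)) (𝓡 d) (extChartAt (𝓡 d) p).symm u) := by
  intro v w h
  have h1 := congrArg (fun T => T v) (mfderiv_extChartAt_comp_symm hu)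
  have h2 := congrArg (fun T => T w) (mfderiv_extChartAt_comp_symm hu)
  simp only [ContinuousLinearMap.comp_apply] at h1 h2
  exact h1.symm.trans ((by rw [h] : _ = _).trans h2)

/-- In the trivialization of the tangent bundle at `p`, a coordinate vector field of the chart at
`p` is a constant basis vector. -/
lemma contMDiffOn_coordVec (p : M) (i : Fin d) :
    ContMDiffOn 𝓘(ℝ, EuclideanSpace ℝ (Fin d)) (𝓡 d).tangent ∞
      (fun u => (⟨(extChartAt (𝓡 d) p).symm u, coordVec p u i⟩ : TangentBundle (𝓡 d) M))
      (extChartAt (𝓡 d) p).target := by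
  let e := trivializationAt (EuclideanSpace ℝ (Fin d)) (TangentSpace (𝓡 d) (M := M)) p
  have hs := contMDiffOn_extChartAt_symm (I := 𝓡 d) (n := ∞) p
  have hmem : ∀ u ∈ (extChartAt (𝓡 d) p).target, (extChartAt (𝓡 d) p).symm u ∈ e.baseSet := by
    intro u hu
    exact extChartAt_symm_mem_chart_source hu
  have hval : ∀ u ∈ (extChartAt (𝓡 d) p).target,
      e ⟨(extChartAt (𝓡 d) p).symm u, coordVec p u i⟩ =
        ((extChartAt (𝓡 d) p).symm u, EuclideanSpace.single i (1 : ℝ)) := by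
    intro u hu
    have h1 := TangentBundle.continuousLinearMapAt_trivializationAt (I := 𝓡 d)
      (extChartAt_symm_mem_chart_source hu)
    have h2 : e ⟨(extChartAt (𝓡 d) p).symm u, coordVec p u i⟩ =
        ((extChartAt (𝓡 d) p).symm u, e.continuousLinearMapAt ℝ _ (coordVec p u i)) := by
      refine Prod.ext (e.coe_fst (by rw [e.mem_source]; exact hmem u hu)) ?_
      rw [Bundle.Trivialization.continuousLinearMapAt_apply,
        e.coe_linearMapAt_of_mem (hmem u hu)]
    rw [h2]
    congr 1
    rw [h1]
    exact congrArg (fun T => T (EuclideanSpace.single i (1 : ℝ))) (mfderiv_extChartAt_comp_symm hu)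
  rw [e.contMDiffOn_iff]
  · refine ⟨hs, ?_⟩
    refine contMDiffOn_const (c := EuclideanSpace.single i (1 : ℝ)) |>.congr fun u hu => ?_
    rw [hval u hu]
  · intro u hu
    rw [e.mem_source]; exact hmem u hu

lemma contDiffOn_gram (g : Metric d M) (p : M) (i j : Fin d) :
    ContDiffOn ℝ ∞ (fun u => gram g p u i j) (extChartAt (𝓡 d) p).target := by
  rw [← contMDiffOn_iff_contDiffOn]
  have hs := contMDiffOn_extChartAt_symm (I := 𝓡 d) (n := ∞) p
  have : ContMDiffOn 𝓘(ℝ, EuclideanSpace ℝ (Fin d)) ((𝓡 d).prod 𝓘(ℝ)) ∞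
      (fun u => Bundle.TotalSpace.mk' ℝ (E := Bundle.Trivial M ℝ) ((extChartAt (𝓡 d) p).symm u)
        (g.inner ((extChartAt (𝓡 d) p).symm u) (coordVec p u i) (coordVec p u j)))
      (extChartAt (𝓡 d) p).target := by
    apply ContMDiffOn.clm_bundle_apply₂ (F₁ := EuclideanSpace ℝ (Fin d))
      (F₂ := EuclideanSpace ℝ (Fin d))
    · exact g.contMDiff.comp_contMDiffOn hs
    · exact contMDiffOn_coordVec p i
    · exact contMDiffOn_coordVec p j
  intro u hu
  have h := this u hu
  rw [Bundle.contMDiffWithinAt_totalSpace] at h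
  exact h.2

/-- The metric in chart coordinates. -/
lemma sum_gram_eq (g : Metric d M) (p : M) (u : EuclideanSpace ℝ (Fin d))
    (a b : Fin d → ℝ) :
    ∑ i, ∑ j, a i * gram g p u i j * b j =
      g.inner ((extChartAt (𝓡 d) p).symm u) (∑ i, a i • coordVec p u i)
        (∑ j, b j • coordVec p u j) := by
  simp only [map_sum, map_smul, sum_apply, smul_apply,
    smul_eq_mul, gram, Matrix.of_apply, Finset.mul_sum]
  rw [Finset.sum_comm]
  refine Finset.sum_congr rfl fun j _ => Finset.sum_congr rfl fun i _ => by ring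

lemma sum_smul_coordVec (p : M) (u : EuclideanSpace ℝ (Fin d)) (a : Fin d → ℝ) :
    ∑ i, a i • coordVec p u i =
      mfderiv 𝓘(ℝ, EuclideanSpace ℝ (Fin d)) (𝓡 d) (extChartAt (𝓡 d) p).symm u
        (WithLp.toLp 2 a) := by
  have : (WithLp.toLp 2 a : EuclideanSpace ℝ (Fin d)) =
      ∑ i, a i • EuclideanSpace.single i (1 : ℝ) := by
    ext k
    simp [Finset.sum_apply, Pi.single_apply]
  rw [this]
  simp only [coordVec]
  exact ((map_sum _ _ _).trans (Finset.sum_congr rfl fun i _ => map_smul _ _ _)).symm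

lemma gram_posDef (g : Metric d M) {p : M} {u : EuclideanSpace ℝ (Fin d)}
    (hu : u ∈ (extChartAt (𝓡 d) p).target) : (gram g p u).PosDef := by
  refine Matrix.PosDef.of_dotProduct_mulVec_pos ?_ fun a ha => ?_
  · ext i j
    simp only [Matrix.conjTranspose_apply, gram, Matrix.of_apply, star_trivial]
    exact g.symm _ _ _
  · have h1 : dotProduct (star a) ((gram g p u).mulVec a) =
        ∑ i, ∑ j, a i * gram g p u i j * a j := by
      simp [dotProduct, Matrix.mulVec, Finset.mul_sum, mul_assoc]
    rw [h1, sum_gram_eq, sum_smul_coordVec]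
    refine g.pos _ _ fun h0 => ha ?_
    have h2 := mfderiv_extChartAt_symm_injective hu (h0.trans (map_zero _).symm)
    exact congrArg WithLp.ofLp h2

lemma density_pos (g : Metric d M) {p : M} {u : EuclideanSpace ℝ (Fin d)}
    (hu : u ∈ (extChartAt (𝓡 d) p).target) : 0 < density g p u :=
  Real.sqrt_pos.2 (gram_posDef g hu).det_pos

lemma contDiffOn_density (g : Metric d M) (p : M) :
    ContDiffOn ℝ ∞ (density g p) (extChartAt (𝓡 d) p).target := by
  have h : ContDiffOn ℝ ∞ (fun u => (gram g p u).det) (extChartAt (𝓡 d) p).target :=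
    Matrix.contDiff_det.comp_contDiffOn (f := fun u => (fun i j => gram g p u i j))
      (contDiffOn_pi.2 fun i => contDiffOn_pi.2 fun j => contDiffOn_gram g p i j)
  exact h.sqrt fun u hu => (gram_posDef g hu).det_pos.ne'

/-- The coordinate representation of a `C¹` family of vector fields is `C¹`. -/
lemma contDiffOn_localRep {V : Type*} [NormedAddCommGroup V] [NormedSpace ℝ V]
    {F : ∀ x : M, V → TangentSpace (𝓡 d) x}
    (hF : ContMDiff ((𝓡 d).prod 𝓘(ℝ, V)) (𝓡 d).tangent 1
      (fun q : M × V => (⟨q.1, F q.1 q.2⟩ : TangentBundle (𝓡 d) M))) (p : M) :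
    ContDiffOn ℝ 1 (fun q : EuclideanSpace ℝ (Fin d) × V => localRep (fun x => F x q.2) p q.1)
      ((extChartAt (𝓡 d) p).target ×ˢ univ) := by
  let e := trivializationAt (EuclideanSpace ℝ (Fin d)) (TangentSpace (𝓡 d) (M := M)) p
  rw [← contMDiffOn_iff_contDiffOn, modelWithCornersSelf_prod, ← chartedSpaceSelf_prod]
  have hs := contMDiffOn_extChartAt_symm (I := 𝓡 d) (n := 1) p
  have hG : ContMDiffOn (𝓘(ℝ, EuclideanSpace ℝ (Fin d)).prod 𝓘(ℝ, V)) (𝓡 d).tangent 1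
      (fun q : EuclideanSpace ℝ (Fin d) × V =>
        (⟨(extChartAt (𝓡 d) p).symm q.1, F _ q.2⟩ : TangentBundle (𝓡 d) M))
      ((extChartAt (𝓡 d) p).target ×ˢ univ) := by
    refine hF.comp_contMDiffOn (f := fun q : EuclideanSpace ℝ (Fin d) × V =>
      ((extChartAt (𝓡 d) p).symm q.1, q.2)) (ContMDiffOn.prodMk ?_ contMDiffOn_snd)
    exact hs.comp contMDiffOn_fst fun q hq => hq.1
  have hmem : ∀ q : EuclideanSpace ℝ (Fin d) × V, q ∈ (extChartAt (𝓡 d) p).target ×ˢ univ →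
      (extChartAt (𝓡 d) p).symm q.1 ∈ e.baseSet :=
    fun q hq => extChartAt_symm_mem_chart_source hq.1
  rw [e.contMDiffOn_iff] at hG
  · refine hG.2.congr fun q hq => ?_
    have h1 := TangentBundle.continuousLinearMapAt_trivializationAt (I := 𝓡 d)
      (extChartAt_symm_mem_chart_source hq.1)
    refine (congrArg (fun T => T (F ((extChartAt (𝓡 d) p).symm q.1) q.2)) h1).symm.trans ?_
    change e.continuousLinearMapAt ℝ _ _ = _
    rw [Bundle.Trivialization.continuousLinearMapAt_apply, e.coe_linearMapAt_of_mem (hmem q hq)]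
  · intro q hq
    rw [e.mem_source]; exact hmem q hq

end Charts

/-! ### The divergence under a change of variables. -/

section Piola

variable {E : Type*} [NormedAddCommGroup E] [NormedSpace ℝ E] [FiniteDimensional ℝ E]

lemma trace_fderiv_smul {ρ : E → ℝ} {V : E → E} {u : E} (hρ : DifferentiableAt ℝ ρ u)
    (hV : DifferentiableAt ℝ V u) :
    LinearMap.trace ℝ E (fderiv ℝ (fun v => ρ v • V v) u : E →ₗ[ℝ] E) =
      ρ u * traceCLM E (fderiv ℝ V u) + fderiv ℝ ρ u (V u) := by
  have h := (hρ.hasFDerivAt.smul hV.hasFDerivAt).fderiv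
  have h' : fderiv ℝ (fun v => ρ v • V v) u = ρ u • fderiv ℝ V u +
      (fderiv ℝ ρ u).smulRight (V u) := h
  rw [h', ← traceCLM_apply, map_add, map_smul, smul_eq_mul]
  congr 1
  exact LinearMap.trace_smulRight _ _

/-- The divergence of a vector field is transformed as a density under a change of variables. -/
lemma trace_fderiv_smul_change {τ : E → E} {V V' : E → E} {ρ ρ' : E → ℝ} {u : E}
    (hτ : ContDiffAt ℝ 2 τ u) (T : E ≃L[ℝ] E) (hT : fderiv ℝ τ u = T)
    (hV : DifferentiableAt ℝ V u) (hV' : DifferentiableAt ℝ V' (τ u))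
    (hρ' : DifferentiableAt ℝ ρ' (τ u))
    (hVV : ∀ᶠ v in 𝓝 u, V' (τ v) = fderiv ℝ τ v (V v))
    (hρρ : ∀ᶠ v in 𝓝 u, ρ v = ρ' (τ v) * |(fderiv ℝ τ v).det|) :
    LinearMap.trace ℝ E (fderiv ℝ (fun v => ρ v • V v) u : E →ₗ[ℝ] E) =
      |(T : E →L[ℝ] E).det| *
        LinearMap.trace ℝ E (fderiv ℝ (fun v => ρ' v • V' v) (τ u) : E →ₗ[ℝ] E) := by
  have hdτ : HasFDerivAt τ (T : E →L[ℝ] E) u :=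
    hT ▸ (hτ.differentiableAt (by norm_num)).hasFDerivAt
  have hS : HasFDerivAt (fderiv ℝ τ) (fderiv ℝ (fderiv ℝ τ) u) u :=
    ((hτ.fderiv_right (m := 1) (by norm_num)).differentiableAt (by norm_num)).hasFDerivAt
  set S := fderiv ℝ (fderiv ℝ τ) u with hSdef
  have hsymm : ∀ a b, S a b = S b a := fun a b =>
    (hτ.isSymmSndFDerivAt (by simp)) a b
  have hdet0 : (T : E →L[ℝ] E).det ≠ 0 := T.toLinearEquiv.isUnit_det'.ne_zero
  -- derivative of the transformed field
  have h1 : HasFDerivAt (fun v => V' (τ v)) ((fderiv ℝ V' (τ u)).comp (T : E →L[ℝ] E)) u :=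
    hV'.hasFDerivAt.comp u hdτ
  have h2 := hS.clm_apply hV.hasFDerivAt
  have h3 := h1.unique (h2.congr_of_eventuallyEq hVV)
  rw [hT] at h3
  -- Differentiate `V' ∘ τ = Dτ · V` and solve for `DV`. Symmetry of the second derivative turns the
  -- correction `e ↦ S e (V u)` into the endomorphism `S (V u)`.
  have h4 : fderiv ℝ V u = ((T.symm : E →L[ℝ] E).comp ((fderiv ℝ V' (τ u)).comp (T : E →L[ℝ] E))) -
      (T.symm : E →L[ℝ] E).comp (S (V u)) := by
    rw [h3]
    ext e
    simp [hsymm e (V u)]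
  have htr : traceCLM E (fderiv ℝ V u) = traceCLM E (fderiv ℝ V' (τ u)) -
      traceCLM E ((T.symm : E →L[ℝ] E).comp (S (V u))) := by
    rw [h4, map_sub]
    congr 1
    have h6 : ((fderiv ℝ V' (τ u)).comp (T : E →L[ℝ] E)).comp (T.symm : E →L[ℝ] E) =
        fderiv ℝ V' (τ u) := by ext e; simp
    refine (LinearMap.trace_comp_comm' ((fderiv ℝ V' (τ u)).comp (T : E →L[ℝ] E) : E →ₗ[ℝ] E)
      ((T.symm : E →L[ℝ] E) : E →ₗ[ℝ] E)).trans ?_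
    exact congrArg (traceCLM E) h6
  -- derivative of the density
  have hJ : HasFDerivAt (fun v => |(fderiv ℝ τ v).det|)
      (|(T : E →L[ℝ] E).det| • (traceCLM E).comp
        ((ContinuousLinearMap.compL ℝ E E E (T.symm : E →L[ℝ] E)).comp S)) u := by
    have hT' := hasFDerivAt_clm_det T
    rw [← hT] at hT'
    have hd := HasFDerivAt.comp (g := fun A : E →L[ℝ] E => A.det) (f := fderiv ℝ τ) u hT' hS
    have habs := (hasDerivAt_abs hdet0)
    rw [← hT] at habs
    have h5 := habs.comp_hasFDerivAt u hd
    refine h5.congr_fderiv ?_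
    ext e
    have : |(T : E →L[ℝ] E).det| =
      (SignType.sign ((T : E →L[ℝ] E).det) : ℝ) * (T : E →L[ℝ] E).det := (sign_mul_self _).symm
    rw [hT]
    simp only [ContinuousLinearMap.comp_apply, smul_apply, smul_eq_mul]
    rw [this, mul_assoc]
  have hρ : HasFDerivAt ρ _ u :=
    ((hρ'.hasFDerivAt.comp u hdτ).mul hJ).congr_of_eventuallyEq hρρ
  have hV'u : V' (τ u) = T (V u) := by rw [hVV.self_of_nhds, hT]; rfl
  have hρu : ρ u = ρ' (τ u) * |(T : E →L[ℝ] E).det| := by rw [hρρ.self_of_nhds, hT]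
  -- The trace of `T⁻¹ ∘ S (V u)` occurs twice with opposite signs, once in the trace of `DV` and
  -- once, by Jacobi's formula, in the derivative of `|det Dτ|`; the two terms cancel.
  rw [trace_fderiv_smul hρ.differentiableAt hV, trace_fderiv_smul hρ' hV', hρ.fderiv, htr, hρu,
    hV'u, hT]
  simp
  ring

end Piola

/-! ### Transition maps, chart independence and continuity of the divergence. -/

section ChartChange

variable {d : ℕ} {M : Type*} [TopologicalSpace M] [ChartedSpace (EuclideanSpace ℝ (Fin d)) M]
  [IsManifold (𝓡 d) ∞ M]

/-- The transition map from the chart at `x` to the chart at `p`. -/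
noncomputable def chartChange (x p : M) (u : EuclideanSpace ℝ (Fin d)) : EuclideanSpace ℝ (Fin d) :=
  extChartAt (𝓡 d) p ((extChartAt (𝓡 d) x).symm u)

/-- The domain of the transition map from the chart at `x` to the chart at `p`. -/
noncomputable def chartOverlap (x p : M) : Set (EuclideanSpace ℝ (Fin d)) :=
  (extChartAt (𝓡 d) x).target ∩ (extChartAt (𝓡 d) x).symm ⁻¹' (extChartAt (𝓡 d) p).source

lemma isOpen_chartOverlap (x p : M) : IsOpen (chartOverlap (d := d) x p) :=
  (continuousOn_extChartAt_symm x).isOpen_inter_preimage (isOpen_extChartAt_target x)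
    (isOpen_extChartAt_source p)

lemma contDiffOn_chartChange (x p : M) :
    ContDiffOn ℝ ∞ (chartChange x p) (chartOverlap (d := d) x p) := by
  have := contDiffOn_ext_coord_change (I := 𝓡 d) (n := ∞) p x
  rwa [PartialEquiv.trans_source] at this

lemma injOn_chartChange (x p : M) : InjOn (chartChange x p) (chartOverlap (d := d) x p) := by
  intro u hu v hv h
  have := (extChartAt (𝓡 d) p).injOn hu.2 hv.2 h
  exact (extChartAt (𝓡 d) x).symm.injOn hu.1 hv.1 this

lemma extChartAt_symm_chartChange {x p : M} {u : EuclideanSpace ℝ (Fin d)}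
    (hu : u ∈ chartOverlap x p) :
    (extChartAt (𝓡 d) p).symm (chartChange x p u) = (extChartAt (𝓡 d) x).symm u :=
  (extChartAt (𝓡 d) p).left_inv hu.2

lemma chartChange_mem_target {x p : M} {u : EuclideanSpace ℝ (Fin d)}
    (hu : u ∈ chartOverlap x p) : chartChange x p u ∈ (extChartAt (𝓡 d) p).target :=
  (extChartAt (𝓡 d) p).map_source hu.2

lemma fderiv_chartChange {x p : M} {u : EuclideanSpace ℝ (Fin d)} (hu : u ∈ chartOverlap x p) :
    fderiv ℝ (chartChange x p) u =
      (mfderiv (𝓡 d) 𝓘(ℝ, EuclideanSpace ℝ (Fin d)) (extChartAt (𝓡 d) p)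
        ((extChartAt (𝓡 d) x).symm u)).comp
      (mfderiv 𝓘(ℝ, EuclideanSpace ℝ (Fin d)) (𝓡 d) (extChartAt (𝓡 d) x).symm u) := by
  rw [← mfderiv_eq_fderiv]
  refine mfderiv_comp u (mdifferentiableAt_extChartAt ?_) ?_
  · rw [← extChartAt_source (𝓡 d)]; exact hu.2
  · have := mdifferentiableWithinAt_extChartAt_symm (I := 𝓡 d) hu.1
    rwa [ModelWithCorners.range_eq_univ, mdifferentiableWithinAt_univ] at this

/-- The derivative of the transition map, as a linear isomorphism. -/
lemma exists_equiv_fderiv_chartChange {x p : M} {u : EuclideanSpace ℝ (Fin d)}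
    (hu : u ∈ chartOverlap x p) :
    ∃ T : EuclideanSpace ℝ (Fin d) ≃L[ℝ] EuclideanSpace ℝ (Fin d),
      fderiv ℝ (chartChange x p) u = T := by
  have h1 : (mfderiv (𝓡 d) 𝓘(ℝ, EuclideanSpace ℝ (Fin d)) (extChartAt (𝓡 d) p)
        ((extChartAt (𝓡 d) x).symm u)).IsInvertible := isInvertible_mfderiv_extChartAt hu.2
  have h2 : (mfderiv 𝓘(ℝ, EuclideanSpace ℝ (Fin d)) (𝓡 d)
      (extChartAt (𝓡 d) x).symm u).IsInvertible := by
    have := isInvertible_mfderivWithin_extChartAt_symm (I := 𝓡 d) hu.1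
    rwa [ModelWithCorners.range_eq_univ, mfderivWithin_univ] at this
  obtain ⟨T, hT⟩ := h1.comp h2
  exact ⟨T, by rw [fderiv_chartChange hu]; exact hT.symm⟩

lemma localRep_extChartAt (X : ∀ p : M, TangentSpace (𝓡 d) p) (p : M) {q : M}
    (hq : q ∈ (extChartAt (𝓡 d) p).source) :
    localRep X p (extChartAt (𝓡 d) p q) =
      mfderiv (𝓡 d) 𝓘(ℝ, EuclideanSpace ℝ (Fin d)) (extChartAt (𝓡 d) p) q (X q) := by
  have h : ∀ q' : M, q' = q → (mfderiv (𝓡 d) 𝓘(ℝ, EuclideanSpace ℝ (Fin d))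
      (extChartAt (𝓡 d) p) q' (X q') : EuclideanSpace ℝ (Fin d)) =
      mfderiv (𝓡 d) 𝓘(ℝ, EuclideanSpace ℝ (Fin d)) (extChartAt (𝓡 d) p) q (X q) := by
    rintro _ rfl; rfl
  exact h _ ((extChartAt (𝓡 d) p).left_inv hq)

lemma localRep_chartChange (X : ∀ p : M, TangentSpace (𝓡 d) p) {x p : M}
    {u : EuclideanSpace ℝ (Fin d)} (hu : u ∈ chartOverlap x p) :
    localRep X p (chartChange x p u) = fderiv ℝ (chartChange x p) u (localRep X x u) := by
  have h1 := localRep_extChartAt X p hu.2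
  have h2 := congrArg (fun T => T (X ((extChartAt (𝓡 d) x).symm u)))
    (mfderiv_symm_comp_extChartAt hu.1)
  refine h1.trans ?_
  rw [fderiv_chartChange hu]
  exact congrArg (mfderiv (𝓡 d) 𝓘(ℝ, EuclideanSpace ℝ (Fin d)) (extChartAt (𝓡 d) p)
    ((extChartAt (𝓡 d) x).symm u)) h2.symm

/-- The metric in the chart at `p`, as a function on pairs of coordinate vectors. -/
noncomputable def chartMetric (g : Metric d M) (p : M) (u a b : EuclideanSpace ℝ (Fin d)) : ℝ :=
  g.inner ((extChartAt (𝓡 d) p).symm u)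
    (mfderiv 𝓘(ℝ, EuclideanSpace ℝ (Fin d)) (𝓡 d) (extChartAt (𝓡 d) p).symm u a)
    (mfderiv 𝓘(ℝ, EuclideanSpace ℝ (Fin d)) (𝓡 d) (extChartAt (𝓡 d) p).symm u b)

lemma mfderiv_symm_chartChange {x p : M} {u : EuclideanSpace ℝ (Fin d)}
    (hu : u ∈ chartOverlap x p) (a : EuclideanSpace ℝ (Fin d)) :
    (mfderiv 𝓘(ℝ, EuclideanSpace ℝ (Fin d)) (𝓡 d) (extChartAt (𝓡 d) p).symm (chartChange x p u)
      (fderiv ℝ (chartChange x p) u a) : EuclideanSpace ℝ (Fin d)) =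
      mfderiv 𝓘(ℝ, EuclideanSpace ℝ (Fin d)) (𝓡 d) (extChartAt (𝓡 d) x).symm u a := by
  have h1 := mfderivWithin_extChartAt_symm_comp_mfderiv_extChartAt' (I := 𝓡 d) hu.2
  rw [ModelWithCorners.range_eq_univ, mfderivWithin_univ] at h1
  rw [fderiv_chartChange hu]
  exact congrArg (fun T => T (mfderiv 𝓘(ℝ, EuclideanSpace ℝ (Fin d)) (𝓡 d)
    (extChartAt (𝓡 d) x).symm u a)) h1

lemma chartMetric_chartChange (g : Metric d M) {x p : M} {u : EuclideanSpace ℝ (Fin d)}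
    (hu : u ∈ chartOverlap x p) (a b : EuclideanSpace ℝ (Fin d)) :
    chartMetric g x u a b = chartMetric g p (chartChange x p u)
      (fderiv ℝ (chartChange x p) u a) (fderiv ℝ (chartChange x p) u b) := by
  have h : ∀ (q q' : M) (v w v' w' : EuclideanSpace ℝ (Fin d)), q = q' → v = v' → w = w' →
      g.inner q v w = g.inner q' v' w' := by
    rintro q _ v w _ _ rfl rfl rfl; rfl
  exact h _ _ _ _ _ _ (extChartAt_symm_chartChange hu).symm
    (mfderiv_symm_chartChange hu a).symm (mfderiv_symm_chartChange hu b).symm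

/-- The Gram matrices in the two charts are congruent through the Jacobian matrix `J`, so their
determinants differ by the factor `det J ^ 2`. -/
lemma density_chartChange (g : Metric d M) {x p : M} {u : EuclideanSpace ℝ (Fin d)}
    (hu : u ∈ chartOverlap x p) :
    density g x u = density g p (chartChange x p u) * |(fderiv ℝ (chartChange x p) u).det| := by
  set T := fderiv ℝ (chartChange x p) u with hT
  let b := (EuclideanSpace.basisFun (Fin d) ℝ).toBasis
  let J : Matrix (Fin d) (Fin d) ℝ := LinearMap.toMatrix b b (T : _ →ₗ[ℝ] _)
  have hJ : J.det = T.det := LinearMap.det_toMatrix b _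
  have hJap : ∀ k i, J k i = T (EuclideanSpace.single i 1) k := by
    intro k i
    simp [J, LinearMap.toMatrix_apply, b]
  have hgram : gram g x u = J.transpose * gram g p (chartChange x p u) * J := by
    ext i j
    have h1 : gram g x u i j = chartMetric g x u (EuclideanSpace.single i 1)
      (EuclideanSpace.single j 1) := rfl
    have h2 := sum_gram_eq g p (chartChange x p u) (fun k => J k i) (fun k => J k j)
    rw [sum_smul_coordVec, sum_smul_coordVec] at h2
    have h3 : ∀ i, (WithLp.toLp 2 (fun k => J k i) : EuclideanSpace ℝ (Fin d)) =
        T (EuclideanSpace.single i 1) := by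
      intro i; ext k; exact hJap k i
    rw [h3, h3] at h2
    rw [h1, chartMetric_chartChange g hu]
    refine h2.symm.trans ?_
    simp only [Matrix.mul_apply, Matrix.transpose_apply, Finset.sum_mul]
    exact Finset.sum_comm
  have hpos := (gram_posDef g (chartChange_mem_target hu)).det_pos
  rw [density, density, hgram, Matrix.det_mul, Matrix.det_mul, Matrix.det_transpose, hJ]
  rw [show T.det * (gram g p (chartChange x p u)).det * T.det =
    (gram g p (chartChange x p u)).det * T.det ^ 2 by ring, Real.sqrt_mul hpos.le,
    Real.sqrt_sq_eq_abs]

/-- The divergence can be computed in any chart. -/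
lemma divergence_eq_of_mem_source (g : Metric d M) (X : ∀ p : M, TangentSpace (𝓡 d) p) (p : M)
    (hX : ∀ x : M, DifferentiableOn ℝ (localRep X x) (extChartAt (𝓡 d) x).target) {q : M}
    (hq : q ∈ (extChartAt (𝓡 d) p).source) :
    divergence g X q = (density g p (extChartAt (𝓡 d) p q))⁻¹ *
      LinearMap.trace ℝ (EuclideanSpace ℝ (Fin d))
      (fderiv ℝ (fun u => density g p u • localRep X p u) (extChartAt (𝓡 d) p q) :
        EuclideanSpace ℝ (Fin d) →ₗ[ℝ] EuclideanSpace ℝ (Fin d)) := by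
  set u := extChartAt (𝓡 d) q q with hu_def
  have hsymm : (extChartAt (𝓡 d) q).symm u = q := extChartAt_to_inv q
  have hu : u ∈ chartOverlap q p := ⟨mem_extChartAt_target q, by rw [mem_preimage, hsymm]; exact hq⟩
  have hcu : chartChange q p u = extChartAt (𝓡 d) p q := by rw [chartChange, hsymm]
  have hnhds := (isOpen_chartOverlap q p).mem_nhds hu
  obtain ⟨T, hT⟩ := exists_equiv_fderiv_chartChange hu
  have ht := chartChange_mem_target hu
  have hmain := trace_fderiv_smul_change (V := localRep X q) (V' := localRep X p)
    (ρ := density g q) (ρ' := density g p)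
    (((contDiffOn_chartChange q p).contDiffAt hnhds).of_le (by norm_cast)) T hT
    ((hX q).differentiableAt ((isOpen_extChartAt_target q).mem_nhds hu.1))
    ((hX p).differentiableAt ((isOpen_extChartAt_target p).mem_nhds ht))
    (((contDiffOn_density g p).contDiffAt
      ((isOpen_extChartAt_target p).mem_nhds ht)).differentiableAt (by simp))
    (by filter_upwards [hnhds] with v hv using localRep_chartChange X hv)
    (by filter_upwards [hnhds] with v hv using density_chartChange g hv)
  rw [divergence, hmain, density_chartChange g hu, hT, hcu]
  have h0 : |(T : EuclideanSpace ℝ (Fin d) →L[ℝ] EuclideanSpace ℝ (Fin d)).det| ≠ 0 :=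
    abs_ne_zero.2 T.toLinearEquiv.isUnit_det'.ne_zero
  field_simp

/-- The divergence of a `C¹` family of vector fields is continuous. -/
lemma continuous_divergence {V : Type*} [NormedAddCommGroup V] [NormedSpace ℝ V]
    (g : Metric d M) {F : ∀ x : M, V → TangentSpace (𝓡 d) x}
    (hF : ContMDiff ((𝓡 d).prod 𝓘(ℝ, V)) (𝓡 d).tangent 1
      (fun q : M × V => (⟨q.1, F q.1 q.2⟩ : TangentBundle (𝓡 d) M))) :
    Continuous fun q : M × V => divergence g (fun x => F x q.2) q.1 := by
  have hdiff : ∀ (v : V) (x : M), DifferentiableOn ℝ (localRep (fun x => F x v) x)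
      (extChartAt (𝓡 d) x).target := by
    intro v x
    exact ((contDiffOn_localRep hF x).differentiableOn (by simp)).comp
      (f := fun u => (u, v)) (by fun_prop) fun u hu => ⟨hu, mem_univ _⟩
  rw [continuous_iff_continuousAt]
  rintro ⟨p, v₀⟩
  set f : EuclideanSpace ℝ (Fin d) × V → EuclideanSpace ℝ (Fin d) :=
    fun q => localRep (fun x => F x q.2) p q.1 with hf
  have hopen : IsOpen ((extChartAt (𝓡 d) p).target ×ˢ (univ : Set V)) :=
    (isOpen_extChartAt_target p).prod isOpen_univ
  have hfc := contDiffOn_localRep hF p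
  -- The definition uses a chart that moves with the point. Chart independence permits computing in
  -- the one chart at `p`, where every ingredient is visibly continuous.
  have hev : ∀ᶠ q : M × V in 𝓝 (p, v₀), divergence g (fun x => F x q.2) q.1 =
      traceCLM _ ((fderiv ℝ f (extChartAt (𝓡 d) p q.1, q.2)).comp
        (ContinuousLinearMap.inl ℝ (EuclideanSpace ℝ (Fin d)) V)) +
      (density g p (extChartAt (𝓡 d) p q.1))⁻¹ *
        fderiv ℝ (density g p) (extChartAt (𝓡 d) p q.1) (f (extChartAt (𝓡 d) p q.1, q.2)) := by
    have hs : (extChartAt (𝓡 d) p).source ×ˢ (univ : Set V) ∈ 𝓝 (p, v₀) :=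
      ((isOpen_extChartAt_source p).prod isOpen_univ).mem_nhds
        ⟨mem_extChartAt_source p, mem_univ _⟩
    filter_upwards [hs] with q hq
    have ht := (extChartAt (𝓡 d) p).map_source hq.1
    have htn := (isOpen_extChartAt_target (I := 𝓡 d) p).mem_nhds ht
    rw [divergence_eq_of_mem_source g _ p (hdiff q.2) hq.1, trace_fderiv_smul
      (((contDiffOn_density g p).contDiffAt htn).differentiableAt (by simp))
      ((hdiff q.2 p).differentiableAt htn)]
    have hpos := density_pos g ht
    have hpart : fderiv ℝ (localRep (fun x => F x q.2) p) (extChartAt (𝓡 d) p q.1) =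
        (fderiv ℝ f (extChartAt (𝓡 d) p q.1, q.2)).comp
          (ContinuousLinearMap.inl ℝ (EuclideanSpace ℝ (Fin d)) V) := by
      have h1 : HasFDerivAt f _ (extChartAt (𝓡 d) p q.1, q.2) :=
        ((hfc.contDiffAt (hopen.mem_nhds ⟨ht, mem_univ _⟩)).differentiableAt (by simp)).hasFDerivAt
      exact (HasFDerivAt.comp (g := f) (f := fun e => (e, q.2)) (extChartAt (𝓡 d) p q.1) h1
        (hasFDerivAt_prodMk_left (extChartAt (𝓡 d) p q.1) q.2)).fderiv
    rw [hpart]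
    field_simp
    rfl
  refine ContinuousAt.congr ?_ (hev.mono fun _ h => h.symm)
  have hκ1 : ContinuousAt (fun q : M × V => extChartAt (𝓡 d) p q.1) (p, v₀) :=
    (continuousAt_extChartAt (I := 𝓡 d) p).comp (f := Prod.fst) (x := (p, v₀)) continuousAt_fst
  have hκ : ContinuousAt (fun q : M × V => (extChartAt (𝓡 d) p q.1, q.2)) (p, v₀) :=
    hκ1.prodMk continuousAt_snd
  have hpt : ((extChartAt (𝓡 d) p p, v₀) : EuclideanSpace ℝ (Fin d) × V) ∈
      (extChartAt (𝓡 d) p).target ×ˢ (univ : Set V) := ⟨mem_extChartAt_target p, mem_univ _⟩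
  have htn := (isOpen_extChartAt_target (I := 𝓡 d) p).mem_nhds (mem_extChartAt_target p)
  have hfc' := hfc.contDiffAt (hopen.mem_nhds hpt)
  have hρc := (contDiffOn_density g p).contDiffAt htn
  have c1 : ContinuousAt (fun q : M × V => fderiv ℝ f (extChartAt (𝓡 d) p q.1, q.2)) (p, v₀) :=
    ContinuousAt.comp (g := fderiv ℝ f) (x := (p, v₀))
      ((hfc'.fderiv_right (m := 0) (by simp)).continuousAt) hκ
  have c2 : ContinuousAt (fun q : M × V => f (extChartAt (𝓡 d) p q.1, q.2)) (p, v₀) :=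
    ContinuousAt.comp (g := f) (x := (p, v₀)) hfc'.continuousAt hκ
  have c3 : ContinuousAt (fun q : M × V => density g p (extChartAt (𝓡 d) p q.1)) (p, v₀) :=
    ContinuousAt.comp (g := density g p) (x := (p, v₀)) hρc.continuousAt hκ1
  have c4 : ContinuousAt (fun q : M × V => fderiv ℝ (density g p) (extChartAt (𝓡 d) p q.1))
      (p, v₀) :=
    ContinuousAt.comp (g := fderiv ℝ (density g p)) (x := (p, v₀))
      ((hρc.fderiv_right (m := 0) (by simp)).continuousAt) hκ1
  refine ContinuousAt.add ?_ ((c3.inv₀ ?_).mul (c4.clm_apply c2))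
  · exact (traceCLM _).continuous.continuousAt.comp (c1.clm_comp continuousAt_const)
  · exact (density_pos g (mem_extChartAt_target p)).ne'

end ChartChange

/-! ### The Riemannian volume on a chart domain. -/

section Volume

lemma measurableSet_inter_preimage_of_continuousOn {X Y : Type*} [TopologicalSpace X]
    [MeasurableSpace X] [OpensMeasurableSpace X] [TopologicalSpace Y] [MeasurableSpace Y]
    [BorelSpace Y] {f : X → Y} {s : Set X} (hf : ContinuousOn f s) (hs : MeasurableSet s)
    {t : Set Y} (ht : MeasurableSet t) : MeasurableSet (s ∩ f ⁻¹' t) := by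
  have h1 : Measurable (s.domRestrict f) := (continuousOn_iff_continuous_domRestrict.1 hf).measurable
  have h2 := hs.subtype_image (h1 ht)
  convert h2 using 1
  ext x
  constructor
  · rintro ⟨hx, hxt⟩
    exact ⟨⟨x, hx⟩, hxt, rfl⟩
  · rintro ⟨⟨y, hy⟩, hyt, rfl⟩
    exact ⟨hy, hyt⟩

variable {d : ℕ} {M : Type*} [TopologicalSpace M] [ChartedSpace (EuclideanSpace ℝ (Fin d)) M]
  [IsManifold (𝓡 d) ∞ M] [MeasurableSpace M] [BorelSpace M]

lemma measurableSet_target_inter_symm_preimage (p : M) {B : Set M} (hB : MeasurableSet B) :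
    MeasurableSet ((extChartAt (𝓡 d) p).target ∩ (extChartAt (𝓡 d) p).symm ⁻¹' B) :=
  measurableSet_inter_preimage_of_continuousOn (continuousOn_extChartAt_symm p)
    (isOpen_extChartAt_target p).measurableSet hB

lemma chartVolume_apply (g : Metric d M) (p : M) {B : Set M} (hB : MeasurableSet B) :
    chartVolume g p B =
      ∫⁻ u in (extChartAt (𝓡 d) p).target ∩ (extChartAt (𝓡 d) p).symm ⁻¹' B,
        ENNReal.ofReal (density g p u) := by
  have hmeas : AEMeasurable (extChartAt (𝓡 d) p).symm
      ((volume.restrict (extChartAt (𝓡 d) p).target).withDensity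
        fun u => ENNReal.ofReal (density g p u)) :=
    ((continuousOn_extChartAt_symm p).aemeasurable
      (isOpen_extChartAt_target p).measurableSet).mono_ac (withDensity_absolutelyContinuous _ _)
  rw [chartVolume, Measure.map_apply_of_aemeasurable hmeas hB, withDensity_apply',
    Measure.restrict_restrict' (isOpen_extChartAt_target p).measurableSet, inter_comm]

/-- The change of variables formula for the transition map, whose Jacobian is exactly the ratio of
the two densities. -/
lemma chartVolume_inter_source_le (g : Metric d M) (x p : M) {B : Set M} (hB : MeasurableSet B) :
    chartVolume g x (B ∩ (extChartAt (𝓡 d) p).source) ≤ chartVolume g p B := by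
  rw [chartVolume_apply g x (hB.inter (isOpen_extChartAt_source p).measurableSet),
    chartVolume_apply g p hB]
  set W := (extChartAt (𝓡 d) x).target ∩
    (extChartAt (𝓡 d) x).symm ⁻¹' (B ∩ (extChartAt (𝓡 d) p).source) with hW
  have hWm : MeasurableSet W := measurableSet_target_inter_symm_preimage x
    (hB.inter (isOpen_extChartAt_source p).measurableSet)
  have hWo : W ⊆ chartOverlap x p := fun u hu => ⟨hu.1, hu.2.2⟩
  have hder : ∀ u ∈ W, HasFDerivWithinAt (chartChange x p) (fderiv ℝ (chartChange x p) u) W u := by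
    intro u hu
    exact (((contDiffOn_chartChange x p).contDiffAt
      ((isOpen_chartOverlap x p).mem_nhds (hWo hu))).differentiableAt
        (by simp)).hasFDerivAt.hasFDerivWithinAt
  have h1 := lintegral_image_eq_lintegral_abs_det_fderiv_mul volume hWm hder
    ((injOn_chartChange x p).mono hWo) fun v => ENNReal.ofReal (density g p v)
  calc ∫⁻ u in W, ENNReal.ofReal (density g x u)
      = ∫⁻ u in W, ENNReal.ofReal |(fderiv ℝ (chartChange x p) u).det| *
          ENNReal.ofReal (density g p (chartChange x p u)) := by
        refine setLIntegral_congr_fun hWm fun u hu => ?_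
        rw [density_chartChange g (hWo hu), mul_comm, ENNReal.ofReal_mul (abs_nonneg _)]
    _ = ∫⁻ v in chartChange x p '' W, ENNReal.ofReal (density g p v) := h1.symm
    _ ≤ _ := by
        refine lintegral_mono_set ?_
        rintro _ ⟨u, hu, rfl⟩
        refine ⟨chartChange_mem_target (hWo hu), ?_⟩
        rw [mem_preimage, extChartAt_symm_chartChange (hWo hu)]
        exact hu.2.1

/-- A supremum of measures is bounded by exhibiting an upper bound on all of `M`. On the domain of
the chart at `p` its chart volume dominates every other one; off it the supremum itself serves. -/
lemma riemannianVolume_le_add (g : Metric d M) (p : M) :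
    riemannianVolume g ≤ chartVolume g p +
      (riemannianVolume g).restrict (extChartAt (𝓡 d) p).sourceᶜ := by
  refine iSup_le fun x => Measure.le_iff.2 fun B hB => ?_
  have hs := (isOpen_extChartAt_source (I := 𝓡 d) p).measurableSet
  rw [Measure.add_apply, Measure.restrict_apply hB, ← measure_inter_add_sdiff B hs, sdiff_eq]
  refine add_le_add (chartVolume_inter_source_le g x p hB) ?_
  exact Measure.le_iff'.1 (le_iSup (fun x : M => chartVolume g x) x) _

lemma chartVolume_le_riemannianVolume (g : Metric d M) (p : M) (B : Set M) :
    chartVolume g p B ≤ riemannianVolume g B :=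
  Measure.le_iff'.1 (le_iSup (fun x : M => chartVolume g x) p) _

/-- In a chart domain the Riemannian volume is at most the maximal density times the Lebesgue
measure. -/
lemma riemannianVolume_le (g : Metric d M) (p : M) {B : Set M} {c : ℝ}
    (hB : B ⊆ (extChartAt (𝓡 d) p).source)
    (hc : ∀ q ∈ B, density g p (extChartAt (𝓡 d) p q) ≤ c) :
    riemannianVolume g B ≤ ENNReal.ofReal c * volume (extChartAt (𝓡 d) p '' B) := by
  set κ := extChartAt (𝓡 d) p with hκ
  have hs := (isOpen_extChartAt_source (I := 𝓡 d) p).measurableSet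
  have ht := (isOpen_extChartAt_target (I := 𝓡 d) p).measurableSet
  set T := toMeasurable volume (κ '' B)
  -- `B` need not be measurable. A measurable hull of its coordinate image is cut down to where the
  -- density is at most `c`, so that the bound on the integrand survives.
  set T' := T ∩ (κ.target ∩ density g p ⁻¹' Iic c) with hT'
  have hT'm : MeasurableSet T' := (measurableSet_toMeasurable _ _).inter
    (measurableSet_inter_preimage_of_continuousOn (contDiffOn_density g p).continuousOn ht
      measurableSet_Iic)
  set B' := κ.source ∩ κ ⁻¹' T'
  have hB'm : MeasurableSet B' :=
    measurableSet_inter_preimage_of_continuousOn (continuousOn_extChartAt p) hs hT'm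
  have hBB' : B ⊆ B' := fun q hq => ⟨hB hq, subset_toMeasurable _ _ (mem_image_of_mem _ hq),
    κ.map_source (hB hq), hc q hq⟩
  calc riemannianVolume g B ≤ riemannianVolume g B' := measure_mono hBB'
    _ ≤ chartVolume g p B' + (riemannianVolume g).restrict κ.sourceᶜ B' :=
        Measure.le_iff'.1 (riemannianVolume_le_add g p) B'
    _ = chartVolume g p B' := by
        have : B' ∩ κ.sourceᶜ = ∅ := by
          ext q; simp only [B', mem_inter_iff, mem_compl_iff, mem_empty_iff_false]; tauto
        rw [Measure.restrict_apply hB'm, this, measure_empty, add_zero]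
    _ = ∫⁻ u in κ.target ∩ κ.symm ⁻¹' B', ENNReal.ofReal (density g p u) :=
        chartVolume_apply g p hB'm
    _ ≤ ∫⁻ u in T', ENNReal.ofReal (density g p u) := by
        refine lintegral_mono_set fun u hu => ?_
        have := hu.2.2
        rwa [mem_preimage, κ.right_inv hu.1] at this
    _ ≤ ∫⁻ _ in T', ENNReal.ofReal c :=
        setLIntegral_mono' hT'm fun u hu => ENNReal.ofReal_le_ofReal hu.2.2
    _ = ENNReal.ofReal c * volume T' := setLIntegral_const _ _
    _ ≤ ENNReal.ofReal c * volume (κ '' B) := by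
        rw [← measure_toMeasurable (κ '' B)]
        gcongr
        exact inter_subset_left

/-- In a chart domain the Riemannian volume is at least the minimal density times the Lebesgue
measure. -/
lemma le_riemannianVolume (g : Metric d M) (p : M) {B : Set M} {c : ℝ}
    (hB : B ⊆ (extChartAt (𝓡 d) p).source)
    (hc : ∀ q ∈ B, c ≤ density g p (extChartAt (𝓡 d) p q)) :
    ENNReal.ofReal c * volume (extChartAt (𝓡 d) p '' B) ≤ riemannianVolume g B := by
  set κ := extChartAt (𝓡 d) p with hκ
  have hs := (isOpen_extChartAt_source (I := 𝓡 d) p).measurableSet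
  have ht := (isOpen_extChartAt_target (I := 𝓡 d) p).measurableSet
  -- Here the quantity to be kept is the Riemannian volume of `B`, so the hull is taken in `M`, not
  -- in coordinates.
  set T := toMeasurable (riemannianVolume g) B
  set V := κ.target ∩ density g p ⁻¹' Ici c
  have hVm : MeasurableSet V :=
    measurableSet_inter_preimage_of_continuousOn (contDiffOn_density g p).continuousOn ht
      measurableSet_Ici
  set B' := T ∩ (κ.source ∩ κ ⁻¹' V)
  have hB'm : MeasurableSet B' := (measurableSet_toMeasurable _ _).inter
    (measurableSet_inter_preimage_of_continuousOn (continuousOn_extChartAt p) hs hVm)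
  have hWm := measurableSet_target_inter_symm_preimage (d := d) p hB'm
  calc ENNReal.ofReal c * volume (κ '' B)
      ≤ ENNReal.ofReal c * volume (κ.target ∩ κ.symm ⁻¹' B') := by
        gcongr
        rintro _ ⟨q, hq, rfl⟩
        refine ⟨κ.map_source (hB hq), ?_⟩
        rw [mem_preimage, κ.left_inv (hB hq)]
        exact ⟨subset_toMeasurable _ _ hq, hB hq, κ.map_source (hB hq), hc q hq⟩
    _ = ∫⁻ _ in κ.target ∩ κ.symm ⁻¹' B', ENNReal.ofReal c := (setLIntegral_const _ _).symm
    _ ≤ ∫⁻ u in κ.target ∩ κ.symm ⁻¹' B', ENNReal.ofReal (density g p u) := by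
        refine setLIntegral_mono' hWm fun u hu => ENNReal.ofReal_le_ofReal ?_
        have := hu.2.2.2.2
        rwa [mem_preimage, κ.right_inv hu.1] at this
    _ = chartVolume g p B' := (chartVolume_apply g p hB'm).symm
    _ ≤ riemannianVolume g B' := chartVolume_le_riemannianVolume g p B'
    _ ≤ riemannianVolume g T := measure_mono inter_subset_left
    _ = riemannianVolume g B := measure_toMeasurable B

end Volume

/-! ### Local-to-global on intervals, and calculus of absolutely continuous curves. -/

section AbsolutelyContinuous

/-- A transitive relation on ordered pairs of a compact interval that holds locally holds
globally. -/
lemma rel_of_local {a b : ℝ} (R : ℝ → ℝ → Prop)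
    (htrans : ∀ r s t, a ≤ r → r ≤ s → s ≤ t → t ≤ b → R r s → R s t → R r t)
    (hloc : ∀ t₀ ∈ Icc a b, ∃ η > 0, ∀ s t, s ∈ Icc a b → t ∈ Icc a b →
      s ∈ Icc (t₀ - η) (t₀ + η) → t ∈ Icc (t₀ - η) (t₀ + η) → s ≤ t → R s t)
    {s t : ℝ} (has : a ≤ s) (hst : s ≤ t) (htb : t ≤ b) : R s t := by
  choose! η hη hR using hloc
  obtain ⟨δ, hδ, hball⟩ := lebesgue_number_lemma_of_metric (s := Icc a b)
    (c := fun t₀ : Icc a b => Metric.ball (t₀ : ℝ) (η t₀)) isCompact_Icc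
    (fun _ => Metric.isOpen_ball)
    (fun t ht => mem_iUnion.2 ⟨⟨t, ht⟩, Metric.mem_ball_self (hη t ht)⟩)
  have hsmall : ∀ s t, a ≤ s → s ≤ t → t ≤ b → t - s < δ → R s t := by
    intro s t has hst htb h
    obtain ⟨t₀, ht₀⟩ := hball s ⟨has, hst.trans htb⟩
    have h1 := ht₀ (Metric.mem_ball_self hδ)
    have h2 : t ∈ Metric.ball (t₀ : ℝ) (η t₀) := ht₀ (by
      rw [Metric.mem_ball, Real.dist_eq, abs_of_nonneg] <;> linarith)
    rw [Real.ball_eq_Ioo] at h1 h2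
    exact hR t₀ t₀.2 s t ⟨has, hst.trans htb⟩ ⟨has.trans hst, htb⟩ (Ioo_subset_Icc_self h1)
      (Ioo_subset_Icc_self h2) hst
  -- Intervals shorter than the Lebesgue number `δ` are covered by the local hypothesis; longer ones
  -- are shortened by steps of length `δ / 2`.
  have hind : ∀ n : ℕ, ∀ s t, a ≤ s → s ≤ t → t ≤ b → t - s < (n + 1) * (δ / 2) → R s t := by
    intro n
    induction n with
    | zero =>
      intro s t has hst htb h
      exact hsmall s t has hst htb (by push_cast at h; linarith)
    | succ n ih =>
      intro s t has hst htb h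
      by_cases hlt : t - s < δ
      · exact hsmall s t has hst htb hlt
      · push Not at hlt
        refine htrans s (t - δ / 2) t has (by linarith) (by linarith) htb
          (ih s _ has (by linarith) (by linarith) ?_)
          (hsmall _ t (by linarith) (by linarith) htb (by linarith))
        push_cast at h
        linarith
  obtain ⟨n, hn⟩ := exists_nat_gt ((t - s) / (δ / 2))
  refine hind n s t has hst htb ?_
  rw [div_lt_iff₀ (by positivity)] at hn
  linarith

lemma _root_.AbsolutelyContinuousOnInterval.lipschitz_comp {X Y : Type*} [PseudoMetricSpace X]
    [PseudoMetricSpace Y] {f : ℝ → X} {a b : ℝ} (hf : AbsolutelyContinuousOnInterval f a b)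
    {φ : X → Y} {K : NNReal} {s : Set X} (hφ : LipschitzOnWith K φ s)
    (hs : ∀ t ∈ uIcc a b, f t ∈ s) : AbsolutelyContinuousOnInterval (fun t => φ (f t)) a b := by
  rw [absolutelyContinuousOnInterval_iff] at hf ⊢
  intro ε hε
  obtain ⟨δ, hδ, h⟩ := hf (ε / (K + 1)) (by positivity)
  refine ⟨δ, hδ, fun P hP hlt => ?_⟩
  have h1 := h P hP hlt
  have h2 : ∑ i ∈ Finset.range P.1, dist (φ (f (P.2 i).1)) (φ (f (P.2 i).2)) ≤
      K * ∑ i ∈ Finset.range P.1, dist (f (P.2 i).1) (f (P.2 i).2) := by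
    rw [Finset.mul_sum]
    refine Finset.sum_le_sum fun i hi => ?_
    have := hP.1 i hi
    exact hφ.dist_le_mul _ (hs _ this.1) _ (hs _ this.2)
  have h3 : (0 : ℝ) ≤ ∑ i ∈ Finset.range P.1, dist (f (P.2 i).1) (f (P.2 i).2) :=
    Finset.sum_nonneg fun _ _ => dist_nonneg
  rw [lt_div_iff₀ (by positivity)] at h1
  nlinarith

/-- The fundamental theorem of calculus for absolutely continuous curves. -/
lemma _root_.AbsolutelyContinuousOnInterval.integral_eq_sub {d : ℕ}
    {f v : ℝ → EuclideanSpace ℝ (Fin d)} {a b : ℝ} (hf : AbsolutelyContinuousOnInterval f a b)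
    (hv : ∀ᵐ t, t ∈ uIcc a b → HasDerivAt f (v t) t) :
    IntervalIntegrable v volume a b ∧ ∫ t in a..b, v t = f b - f a := by
  -- The scalar fundamental theorem is applied to each coordinate, coordinate projections being
  -- `1`-Lipschitz.
  have hcomp : ∀ i, AbsolutelyContinuousOnInterval (fun t => f t i) a b := fun i =>
    hf.lipschitz_comp (φ := fun x : EuclideanSpace ℝ (Fin d) => x i) (s := univ) (K := 1)
      (LipschitzWith.lipschitzOnWith (LipschitzWith.of_dist_le_mul fun x y => by
        simpa [dist_eq_norm] using PiLp.norm_apply_le (x - y) i)) fun _ _ => mem_univ _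
  have hder : ∀ i, ∀ᵐ t, t ∈ uIoc a b → deriv (fun t => f t i) t = v t i := by
    intro i
    filter_upwards [hv] with t ht htm
    exact ((EuclideanSpace.proj i : EuclideanSpace ℝ (Fin d) →L[ℝ] ℝ).hasFDerivAt.comp_hasDerivAt t
      (ht (uIoc_subset_uIcc htm))).deriv
  have hint : ∀ i, IntervalIntegrable (fun t => v t i) volume a b := by
    intro i
    refine (hcomp i).intervalIntegrable_deriv.congr_ae ?_
    rw [EventuallyEq, ae_restrict_iff' measurableSet_uIoc]
    exact hder i
  have hvint : IntervalIntegrable v volume a b := by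
    rw [intervalIntegrable_iff]
    exact Integrable.of_eval_piLp fun i => intervalIntegrable_iff.1 (hint i)
  refine ⟨hvint, ?_⟩
  ext i
  have h1 := (EuclideanSpace.proj i : EuclideanSpace ℝ (Fin d) →L[ℝ] ℝ).intervalIntegral_comp_comm
    hvint
  have h2 := (hcomp i).integral_deriv_eq_sub
  rw [intervalIntegral.integral_congr_ae (hder i)] at h2
  exact h1.symm.trans h2

end AbsolutelyContinuous

/-! ### Trajectories in an arbitrary chart. -/

section Trajectories

variable {d m : ℕ} {M : Type*} [TopologicalSpace M] [ChartedSpace (EuclideanSpace ℝ (Fin d)) M]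
  [IsManifold (𝓡 d) ∞ M] {F : ∀ x : M, EuclideanSpace ℝ (Fin m) → TangentSpace (𝓡 d) x}
  {w : ℝ → EuclideanSpace ℝ (Fin m)} {x : M} {γ : ℝ → M}

lemma IsTrajectory.ae_hasDerivAt (hγ : IsTrajectory F w x γ) (p : M) :
    ∀ᵐ t : ℝ, γ t ∈ (extChartAt (𝓡 d) p).source →
      HasDerivAt (fun t => extChartAt (𝓡 d) p (γ t))
        (localRep (fun x => F x (w t)) p (extChartAt (𝓡 d) p (γ t))) t := by
  filter_upwards [hγ.equation] with t ht hs
  have h1 : HasMFDerivAt (𝓡 d) 𝓘(ℝ, EuclideanSpace ℝ (Fin d)) (extChartAt (𝓡 d) p) (γ t)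
      (mfderiv (𝓡 d) 𝓘(ℝ, EuclideanSpace ℝ (Fin d)) (extChartAt (𝓡 d) p) (γ t)) :=
    (mdifferentiableAt_extChartAt (by rwa [← extChartAt_source (𝓡 d)])).hasMFDerivAt
  let L : ℝ →L[ℝ] EuclideanSpace ℝ (Fin d) :=
    (mfderiv (𝓡 d) 𝓘(ℝ, EuclideanSpace ℝ (Fin d)) (extChartAt (𝓡 d) p) (γ t)).comp
      ((1 : ℝ →L[ℝ] ℝ).smulRight (F (γ t) (w t)))
  have h2 : HasFDerivAt (fun t => extChartAt (𝓡 d) p (γ t)) L t := (h1.comp t ht).hasFDerivAt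
  have h3 := h2.hasDerivAt
  rw [localRep_extChartAt _ p hs]
  refine h3.congr_deriv ?_
  have h4 : (1 : ℝ →L[ℝ] ℝ).smulRight (F (γ t) (w t)) (1 : ℝ) = F (γ t) (w t) := by
    simp
  exact congrArg (mfderiv (𝓡 d) 𝓘(ℝ, EuclideanSpace ℝ (Fin d)) (extChartAt (𝓡 d) p) (γ t)) h4

/-- A trajectory is by definition absolutely continuous only in the chart at its own point `γ t₀`.
The transition map to the chart at `p` is `C¹`, hence locally Lipschitz, and Lipschitz maps preserve
absolute continuity. -/
lemma IsTrajectory.exists_absolutelyContinuous (hγ : IsTrajectory F w x γ) (p : M) {t₀ : ℝ}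
    (ht₀ : γ t₀ ∈ (extChartAt (𝓡 d) p).source) :
    ∃ ε > 0, AbsolutelyContinuousOnInterval (fun t => extChartAt (𝓡 d) p (γ t))
      (t₀ - ε) (t₀ + ε) := by
  obtain ⟨ε₁, hε₁, hs, hac⟩ := hγ.locallyAC t₀
  set κ₀ := extChartAt (𝓡 d) (γ t₀) with hκ₀
  have hu : κ₀ (γ t₀) ∈ chartOverlap (γ t₀) p :=
    ⟨mem_extChartAt_target _, by
      rw [mem_preimage, extChartAt_to_inv]; exact ht₀⟩
  have hC : ContDiffAt ℝ 1 (chartChange (γ t₀) p) (κ₀ (γ t₀)) :=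
    ((contDiffOn_chartChange (γ t₀) p).contDiffAt
      ((isOpen_chartOverlap _ _).mem_nhds hu)).of_le (by norm_cast)
  obtain ⟨K, V, hV, hK⟩ := hC.exists_lipschitzOnWith
  have hcont : ContinuousAt (fun t => κ₀ (γ t)) t₀ :=
    ContinuousAt.comp (g := κ₀) (continuousAt_extChartAt (γ t₀)) hγ.continuous.continuousAt
  obtain ⟨ε₂, hε₂, hV₂⟩ := Metric.mem_nhds_iff.1 (hcont.preimage_mem_nhds hV)
  have hmin : 0 < min ε₁ (ε₂ / 2) := lt_min hε₁ (by positivity)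
  have hIcc : uIcc (t₀ - min ε₁ (ε₂ / 2)) (t₀ + min ε₁ (ε₂ / 2)) =
      Icc (t₀ - min ε₁ (ε₂ / 2)) (t₀ + min ε₁ (ε₂ / 2)) := uIcc_of_le (by linarith)
  have hsub : Icc (t₀ - min ε₁ (ε₂ / 2)) (t₀ + min ε₁ (ε₂ / 2)) ⊆
      Icc (t₀ - ε₁) (t₀ + ε₁) := by
    refine Icc_subset_Icc ?_ ?_ <;> linarith [min_le_left ε₁ (ε₂ / 2)]
  refine ⟨min ε₁ (ε₂ / 2), hmin, ?_⟩
  have h1 := (hac.mono (c := t₀ - min ε₁ (ε₂ / 2)) (d := t₀ + min ε₁ (ε₂ / 2)) (by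
    rw [hIcc, uIcc_of_le (by linarith)]; exact hsub)).lipschitz_comp hK (fun t ht => by
      refine hV₂ ?_
      rw [hIcc] at ht
      rw [Metric.mem_ball, Real.dist_eq, abs_lt]
      constructor <;> linarith [ht.1, ht.2, min_le_right ε₁ (ε₂ / 2)])
  have heq : ∀ t ∈ uIcc (t₀ - min ε₁ (ε₂ / 2)) (t₀ + min ε₁ (ε₂ / 2)),
      chartChange (γ t₀) p (κ₀ (γ t)) = extChartAt (𝓡 d) p (γ t) := by
    intro t ht
    rw [hIcc] at ht
    rw [chartChange, κ₀.left_inv (hs t (hsub ht))]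
  rw [absolutelyContinuousOnInterval_iff] at h1 ⊢
  intro ε hε
  obtain ⟨δ, hδ, h⟩ := h1 ε hε
  refine ⟨δ, hδ, fun P hP hlt => ?_⟩
  refine lt_of_eq_of_lt (Finset.sum_congr rfl fun i hi => ?_) (h P hP hlt)
  have := hP.1 i hi
  rw [heq _ this.1, heq _ this.2]

/-- The integral equation for a trajectory that stays in a chart domain. -/
lemma IsTrajectory.integral_localRep (hγ : IsTrajectory F w x γ) (p : M) {a b : ℝ} (hab : a ≤ b)
    (hs : ∀ t ∈ Icc a b, γ t ∈ (extChartAt (𝓡 d) p).source) :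
    IntervalIntegrable (fun t => localRep (fun x => F x (w t)) p (extChartAt (𝓡 d) p (γ t)))
      volume a b ∧
    ∫ t in a..b, localRep (fun x => F x (w t)) p (extChartAt (𝓡 d) p (γ t)) =
      extChartAt (𝓡 d) p (γ b) - extChartAt (𝓡 d) p (γ a) := by
  set v : ℝ → EuclideanSpace ℝ (Fin d) :=
    fun t => localRep (fun x => F x (w t)) p (extChartAt (𝓡 d) p (γ t))
  refine rel_of_local (a := a) (b := b) (fun s t => IntervalIntegrable v volume s t ∧
    ∫ r in s..t, v r = extChartAt (𝓡 d) p (γ t) - extChartAt (𝓡 d) p (γ s)) ?_ ?_ le_rfl hab le_rfl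
  · rintro r s t - - - - ⟨h1, h2⟩ ⟨h3, h4⟩
    refine ⟨h1.trans h3, ?_⟩
    rw [← intervalIntegral.integral_add_adjacent_intervals h1 h3, h2, h4]
    abel
  · intro t₀ ht₀
    obtain ⟨η, hη, hac⟩ := hγ.exists_absolutelyContinuous p (hs t₀ ht₀)
    refine ⟨η, hη, fun s t hsI htI hs' ht' hst => ?_⟩
    refine (hac.mono ?_).integral_eq_sub ?_
    · rw [uIcc_of_le hst, uIcc_of_le (by linarith)]
      exact Icc_subset_Icc hs'.1 ht'.2
    · filter_upwards [hγ.ae_hasDerivAt p] with r hr hrm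
      rw [uIcc_of_le hst] at hrm
      exact hr (hs r ⟨hsI.1.trans hrm.1, hrm.2.trans htI.2⟩)

end Trajectories

/-! ### The difference of two trajectories. -/

section PairEstimate

variable {E : Type*} [NormedAddCommGroup E] [NormedSpace ℝ E] [CompleteSpace E]

/-- Gronwall-type estimates on short time intervals, backward in time, for an almost linear
integral equation. -/
lemma norm_sub_le_of_integral_eq {a b δ L : ℝ} (hba : b ≤ a) (hδ : 0 ≤ δ) (hL : 0 ≤ L)
    (hη : (L + δ) * (a - b) ≤ 1 / 2) {Δ h : ℝ → E} {D : ℝ → E →L[ℝ] E}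
    (hΔ : ContinuousOn Δ (Icc b a)) (hh : ∀ t ∈ Icc b a, IntervalIntegrable h volume t a)
    (hint : ∀ t ∈ Icc b a, ∫ r in t..a, h r = Δ a - Δ t)
    (hD : IntervalIntegrable D volume b a)
    (hDL : ∀ᵐ r, r ∈ Icc b a → ‖D r‖ ≤ L)
    (hhD : ∀ᵐ r, r ∈ Icc b a → ‖h r - D r (Δ r)‖ ≤ δ * ‖Δ r‖) :
    (∀ t ∈ Icc b a, ‖Δ t‖ ≤ 2 * ‖Δ a‖) ∧
    ‖Δ b - (1 + -∫ r in b..a, D r) (Δ a)‖ ≤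
      (2 * δ + 2 * L * (L + δ) * (a - b)) * (a - b) * ‖Δ a‖ := by
  have hη0 : 0 ≤ a - b := by linarith
  have hhb : ∀ᵐ r, r ∈ Icc b a → ‖h r‖ ≤ (L + δ) * ‖Δ r‖ := by
    filter_upwards [hDL, hhD] with r h1 h2 hr
    have h3 := (D r).le_of_opNorm_le (h1 hr) (Δ r)
    have h4 : ‖h r‖ ≤ ‖h r - D r (Δ r)‖ + ‖D r (Δ r)‖ := by
      simpa using norm_add_le (h r - D r (Δ r)) (D r (Δ r))
    linarith [h2 hr]
  have hstep : ∀ B, (∀ r ∈ Icc b a, ‖Δ r‖ ≤ B) → ∀ t ∈ Icc b a,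
      ‖Δ a - Δ t‖ ≤ (L + δ) * B * (a - b) := by
    intro B hB t ht
    have hB0 : 0 ≤ B := (norm_nonneg _).trans (hB t ht)
    rw [← hint t ht]
    have h1 : ‖∫ r in t..a, h r‖ ≤ (L + δ) * B * |a - t| := by
      refine intervalIntegral.norm_integral_le_of_norm_le_const_ae ?_
      filter_upwards [hhb] with r hr hrm
      rw [uIoc_of_le ht.2] at hrm
      have hr' : r ∈ Icc b a := ⟨ht.1.trans hrm.1.le, hrm.2⟩
      exact (hr hr').trans (by gcongr; exact hB r hr')
    refine h1.trans ?_
    rw [abs_of_nonneg (by linarith [ht.2])]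
    gcongr
    exact ht.1
  have hbd : ∀ t ∈ Icc b a, ‖Δ t‖ ≤ 2 * ‖Δ a‖ := by
    -- On so short an interval the maximum `‖Δ s‖` is at most `‖Δ a‖ + ‖Δ s‖ / 2`, and the last term
    -- is absorbed on the left.
    obtain ⟨s, hs, hmax⟩ := isCompact_Icc.exists_isMaxOn (nonempty_Icc.2 hba) hΔ.norm
    have hmax' : ∀ r ∈ Icc b a, ‖Δ r‖ ≤ ‖Δ s‖ := fun r hr => hmax hr
    have h1 := hstep _ hmax' s hs
    have h2 : ‖Δ s‖ ≤ ‖Δ a‖ + ‖Δ a - Δ s‖ := by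
      simpa using norm_sub_le (Δ a) (Δ a - Δ s)
    have h3 : (L + δ) * ‖Δ s‖ * (a - b) ≤ 1 / 2 * ‖Δ s‖ := by
      nlinarith [norm_nonneg (Δ s)]
    intro t ht
    linarith [hmax' t ht]
  refine ⟨hbd, ?_⟩
  have hDa : IntervalIntegrable (fun r => D r (Δ a)) volume b a :=
    ⟨(ContinuousLinearMap.apply ℝ E (Δ a)).integrable_comp hD.1,
      (ContinuousLinearMap.apply ℝ E (Δ a)).integrable_comp hD.2⟩
  have hb : b ∈ Icc b a := left_mem_Icc.2 hba
  have heq : Δ b - (1 + -∫ r in b..a, D r) (Δ a) =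
      -∫ r in b..a, (h r - D r (Δ a)) := by
    rw [intervalIntegral.integral_sub (hh b hb) hDa, hint b hb]
    have h1 : ∫ r in b..a, D r (Δ a) = (∫ r in b..a, D r) (Δ a) :=
      (ContinuousLinearMap.apply ℝ E (Δ a)).intervalIntegral_comp_comm hD
    rw [h1]
    simp only [add_apply, neg_apply, one_apply_eq_self]
    abel
  rw [heq, norm_neg]
  have h1 : ‖∫ r in b..a, (h r - D r (Δ a))‖ ≤
      ((2 * δ + 2 * L * (L + δ) * (a - b)) * ‖Δ a‖) * |a - b| := by
    refine intervalIntegral.norm_integral_le_of_norm_le_const_ae ?_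
    filter_upwards [hDL, hhD] with r h1 h2 hrm
    rw [uIoc_of_le hba] at hrm
    have hr : r ∈ Icc b a := Ioc_subset_Icc_self hrm
    have h3 := hstep _ hbd r hr
    have h4 : ‖D r (Δ a - Δ r)‖ ≤ L * ((L + δ) * (2 * ‖Δ a‖) * (a - b)) :=
      ((D r).le_of_opNorm_le (h1 hr) _).trans (by gcongr)
    -- Two errors: the nonlinearity, giving `2 * δ`, and freezing `Δ` at time `a`, giving the term
    -- in `L * (L + δ) * (a - b)`, which is of second order in time after integration.
    have h5 : h r - D r (Δ a) = (h r - D r (Δ r)) - D r (Δ a - Δ r) := by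
      rw [map_sub]; abel
    rw [h5]
    refine (norm_sub_le _ _).trans ?_
    have h6 : ‖h r - D r (Δ r)‖ ≤ δ * (2 * ‖Δ a‖) :=
      (h2 hr).trans (by gcongr; exact hbd r hr)
    linarith
  rw [abs_of_nonneg hη0] at h1
  linarith

end PairEstimate

/-! ### Linearization uniform in the control value. -/

section UniformEstimates

variable {E V : Type*} [NormedAddCommGroup E] [NormedSpace ℝ E] [NormedAddCommGroup V]
  [NormedSpace ℝ V] {f : E × V → E} {T : Set E} {c : E} {U : Set V}

/-- The partial derivative of `f` in the first variable at the point `c`. -/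
noncomputable def partialDeriv (f : E × V → E) (c : E) (v : V) : E →L[ℝ] E :=
  (fderiv ℝ f (c, v)).comp (ContinuousLinearMap.inl ℝ E V)

lemma continuousOn_partialDeriv (hT : IsOpen T) (hf : ContDiffOn ℝ 1 f (T ×ˢ univ)) :
    ContinuousOn (fun q : E × V => partialDeriv f q.1 q.2) (T ×ˢ univ) :=
  (hf.continuousOn_fderiv_of_isOpen (hT.prod isOpen_univ) le_rfl).clm_comp continuousOn_const

lemma continuous_partialDeriv (hT : IsOpen T) (hf : ContDiffOn ℝ 1 f (T ×ˢ univ)) (hc : c ∈ T) :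
    Continuous (partialDeriv f c) :=
  (continuousOn_partialDeriv hT hf).comp_continuous (f := fun v => (c, v)) (by fun_prop)
    fun v => ⟨hc, mem_univ v⟩

/-- Compactness of `U` yields one ball on which the partial derivative stays within `δ` of its value
at `c` for all control values; the mean value inequality on this convex ball does the rest. -/
lemma exists_closedBall_norm_sub_le (hT : IsOpen T) (hf : ContDiffOn ℝ 1 f (T ×ˢ univ))
    (hc : c ∈ T) (hU : IsCompact U) {δ : ℝ} (hδ : 0 < δ) :
    ∃ R > 0, Metric.closedBall c R ⊆ T ∧ ∀ v ∈ U, ∀ y ∈ Metric.closedBall c R,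
      ∀ z ∈ Metric.closedBall c R,
      ‖f (y, v) - f (z, v) - partialDeriv f c v (y - z)‖ ≤ δ * ‖y - z‖ := by
  have hev : ∀ᶠ u in 𝓝 c, ∀ v ∈ U, u ∈ T ∧ ‖partialDeriv f u v - partialDeriv f c v‖ ≤ δ := by
    refine hU.eventually_forall_of_forall_eventually fun v _ => ?_
    have hmem : ((c, v) : E × V) ∈ T ×ˢ (univ : Set V) := ⟨hc, mem_univ v⟩
    have h1 : ContinuousAt (fun q : E × V => partialDeriv f q.1 q.2 - partialDeriv f c q.2)
        (c, v) :=
      ((continuousOn_partialDeriv hT hf).continuousAt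
        ((hT.prod isOpen_univ).mem_nhds hmem)).sub
        ((continuous_partialDeriv hT hf hc).continuousAt.comp continuousAt_snd)
    have h2 : ∀ᶠ q : E × V in 𝓝 (c, v), ‖partialDeriv f q.1 q.2 - partialDeriv f c q.2‖ < δ := by
      refine h1.norm.eventually (gt_mem_nhds ?_)
      simpa using hδ
    filter_upwards [h2, (hT.prod isOpen_univ).mem_nhds hmem] with q hq hq'
    exact ⟨hq'.1, hq.le⟩
  obtain ⟨R₁, hR₁, hball⟩ := Metric.eventually_nhds_iff.1 (hev.and (hT.mem_nhds hc))
  have hmem : ∀ u ∈ Metric.closedBall c (R₁ / 2), dist u c < R₁ := by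
    intro u hu
    have := Metric.mem_closedBall.1 hu
    linarith
  refine ⟨R₁ / 2, by positivity, fun u hu => (hball (hmem u hu)).2, fun v hv y hy z hz => ?_⟩
  refine (convex_closedBall c (R₁ / 2)).norm_image_sub_le_of_norm_hasFDerivWithin_le'
    (f := fun u => f (u, v)) (f' := fun u => partialDeriv f u v) (fun u hu => ?_)
    (fun u hu => ((hball (hmem u hu)).1 v hv).2) hz hy
  have huT : u ∈ T := (hball (hmem u hu)).2
  have h1 : HasFDerivAt f _ (u, v) :=
    ((hf.contDiffAt ((hT.prod isOpen_univ).mem_nhds ⟨huT, mem_univ v⟩)).differentiableAt (by simp)).hasFDerivAt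
  exact (HasFDerivAt.comp (g := f) (f := fun e => (e, v)) u h1
    (hasFDerivAt_prodMk_left u v)).hasFDerivWithinAt

end UniformEstimates

/-! ### Lebesgue volume along solutions near a point. -/

section VolumeEstimate

variable {E V : Type*} [NormedAddCommGroup E] [InnerProductSpace ℝ E] [FiniteDimensional ℝ E]
  [MeasurableSpace E] [BorelSpace E] [NormedAddCommGroup V]
  [NormedSpace ℝ V] [MeasurableSpace V] [BorelSpace V] [SecondCountableTopology V]
  {f : E × V → E} {T : Set E} {c : E} {U : Set V}

lemma intervalIntegrable_comp_of_isCompact {G : Type*} [NormedAddCommGroup G] {D : V → G}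
    (hD : Continuous D) (hU : IsCompact U) {w : ℝ → V} (hw : AEMeasurable w volume)
    (hwU : ∀ᵐ t, w t ∈ U) (a b : ℝ) :
    IntervalIntegrable (fun t => D (w t)) volume a b := by
  obtain ⟨L, hL⟩ := (hU.image hD).isBounded.exists_norm_le
  refine (intervalIntegrable_const (c := L)).mono_fun
    ((hD.comp_aestronglyMeasurable hw.aestronglyMeasurable).restrict) ?_
  refine ae_restrict_of_ae ?_
  filter_upwards [hwU] with t ht
  exact (hL _ (mem_image_of_mem _ ht)).trans (Real.le_norm_self L)

/-- The local estimate for the change of volume along solutions of `y' = f (y, w)`, backward in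
time, near a point `c`. -/
lemma exists_local_volume_estimate (hT : IsOpen T) (hf : ContDiffOn ℝ 1 f (T ×ˢ univ))
    (hc : c ∈ T) (hU : IsCompact U) {ε : ℝ} (hε : 0 < ε) :
    ∃ R > 0, ∃ η > 0, Metric.closedBall c R ⊆ T ∧
      ∀ (w : ℝ → V), AEMeasurable w volume → (∀ᵐ t, w t ∈ U) →
      ∀ (a b : ℝ), b ≤ a → a - b ≤ η → ∀ {ι : Type*} (Y : ι → ℝ → E) (A : Set ι),
        (∀ i ∈ A, ContinuousOn (Y i) (Icc b a)) →
        (∀ i ∈ A, ∀ t ∈ Icc b a, Y i t ∈ Metric.closedBall c R) →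
        (∀ i ∈ A, ∀ t ∈ Icc b a, IntervalIntegrable (fun r => f (Y i r, w r)) volume t a ∧
          ∫ r in t..a, f (Y i r, w r) = Y i a - Y i t) →
        (∀ i ∈ A, ∀ j ∈ A, ∀ t ∈ Icc b a, ‖Y i t - Y j t‖ ≤ 2 * ‖Y i a - Y j a‖) ∧
        volume ((fun i => Y i b) '' A) ≤ ENNReal.ofReal
          (Real.exp (-(∫ r in b..a, traceCLM E (partialDeriv f c (w r))) + ε * (a - b))) *
          volume ((fun i => Y i a) '' A) := by
  obtain ⟨L, hL0, hL⟩ : ∃ L : ℝ, 0 ≤ L ∧ ∀ v ∈ U, ‖partialDeriv f c v‖ ≤ L := by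
    obtain ⟨L, hL⟩ := (hU.image (continuous_partialDeriv hT hf hc)).isBounded.exists_norm_le
    exact ⟨max L 0, le_max_right _ _, fun v hv =>
      (hL _ (mem_image_of_mem _ hv)).trans (le_max_left _ _)⟩
  set n : ℝ := (Module.finrank ℝ E : ℝ) with hn
  have hn0 : 0 ≤ n := Nat.cast_nonneg _
  obtain ⟨δ₁, hδ₁, hdet⟩ := exists_abs_det_one_add_le (E := E)
    (ε := ε / (3 * (L + 1))) (by positivity)
  -- The exponent may err by `ε` per unit time, split into three parts of at most `ε / 3`: the
  -- determinant expansion, the nonlinearity `δ`, and the second-order term in time.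
  set δ := min 1 (ε / (12 * (n + 1))) with hδdef
  have hδ : 0 < δ := lt_min one_pos (by positivity)
  have hδ1 : δ ≤ 1 := min_le_left _ _
  have hδ2 : δ * (12 * (n + 1)) ≤ ε := by
    rw [← le_div_iff₀ (by positivity)]; exact min_le_right _ _
  obtain ⟨R, hR, hRT, hfR⟩ := exists_closedBall_norm_sub_le hT hf hc hU hδ
  -- The three bounds serve, in order, the smallness condition `(L + δ) * (a - b) ≤ 1 / 2`, the
  -- range `‖S‖ ≤ δ₁` of the determinant expansion, and the second-order part of the error.
  set η := min (1 / (2 * (L + 1))) (min (δ₁ / (L + 1)) (ε / (12 * (n + 1) * (L + 1) * (L + 1))))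
    with hηdef
  have hη : 0 < η := lt_min (by positivity) (lt_min (by positivity) (by positivity))
  have hη1 : η * (2 * (L + 1)) ≤ 1 := by
    rw [← le_div_iff₀ (by positivity)]; exact min_le_left _ _
  have hη2 : η * (L + 1) ≤ δ₁ := by
    rw [← le_div_iff₀ (by positivity)]; exact (min_le_right _ _).trans (min_le_left _ _)
  have hη3 : η * (12 * (n + 1) * (L + 1) * (L + 1)) ≤ ε := by
    rw [← le_div_iff₀ (by positivity)]; exact (min_le_right _ _).trans (min_le_right _ _)
  refine ⟨R, hR, η, hη, hRT, fun w hw hwU a b hba hab ι Y A hYc hYR hYint => ?_⟩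
  set s := a - b with hs
  have hs0 : 0 ≤ s := by linarith
  set D : ℝ → E →L[ℝ] E := fun r => partialDeriv f c (w r) with hDdef
  have hDint : IntervalIntegrable D volume b a :=
    intervalIntegrable_comp_of_isCompact (continuous_partialDeriv hT hf hc) hU hw hwU b a
  have hDL : ∀ᵐ r, r ∈ Icc b a → ‖D r‖ ≤ L := by
    filter_upwards [hwU] with r hr _ using hL _ hr
  have hpair : ∀ i ∈ A, ∀ j ∈ A, (∀ t ∈ Icc b a, ‖Y i t - Y j t‖ ≤ 2 * ‖Y i a - Y j a‖) ∧
      ‖Y i b - Y j b - (1 + -∫ r in b..a, D r) (Y i a - Y j a)‖ ≤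
        (2 * δ + 2 * L * (L + δ) * s) * s * ‖Y i a - Y j a‖ := by
    intro i hi j hj
    refine norm_sub_le_of_integral_eq (Δ := fun t => Y i t - Y j t)
      (h := fun r => f (Y i r, w r) - f (Y j r, w r)) hba hδ.le hL0 ?_
      ((hYc i hi).sub (hYc j hj)) (fun t ht => (hYint i hi t ht).1.sub (hYint j hj t ht).1)
      (fun t ht => ?_) hDint hDL ?_
    · have : (L + δ) * s ≤ (L + 1) * η := by gcongr
      linarith
    · rw [intervalIntegral.integral_sub (hYint i hi t ht).1 (hYint j hj t ht).1,
        (hYint i hi t ht).2, (hYint j hj t ht).2]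
      abel
    · filter_upwards [hwU] with r hr hrm
      exact hfR _ hr _ (hYR i hi r hrm) _ (hYR j hj r hrm)
  refine ⟨fun i hi j hj => (hpair i hi j hj).1, ?_⟩
  set S : E →L[ℝ] E := -∫ r in b..a, D r with hS
  have hSL : ‖S‖ ≤ L * s := by
    rw [hS, norm_neg]
    have h1 : ‖∫ r in b..a, D r‖ ≤ L * |a - b| := by
      refine intervalIntegral.norm_integral_le_of_norm_le_const_ae ?_
      filter_upwards [hDL] with r hr hrm
      rw [uIoc_of_le hba] at hrm
      exact hr (Ioc_subset_Icc_self hrm)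
    rwa [abs_of_nonneg hs0] at h1
  have hLs : L * s ≤ (L + 1) * η := by gcongr; linarith
  have hvol := volume_image_le_of_approx_linear S (by linarith)
    (c := (2 * δ + 2 * L * (L + δ) * s) * s) (by positivity) (fun i => Y i a) (fun i => Y i b) A
    (fun i hi j hj => (hpair i hi j hj).2)
  refine hvol.trans ?_
  gcongr
  have htr : LinearMap.trace ℝ E (S : E →ₗ[ℝ] E) = -∫ r in b..a, traceCLM E (D r) := by
    rw [← traceCLM_apply, hS, map_neg, (traceCLM E).intervalIntegral_comp_comm hDint]
  have h1 := hdet S (by linarith)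
  rw [htr] at h1
  set k := (2 * δ + 2 * L * (L + δ) * s) * s with hk
  have hk0 : 0 ≤ k := by positivity
  have h2 : (1 + 2 * k) ^ Module.finrank ℝ E ≤ Real.exp (n * (2 * k)) := by
    rw [hn, Real.exp_nat_mul]
    gcongr
    linarith [Real.add_one_le_exp (2 * k)]
  refine (mul_le_mul h1 h2 (by positivity) (Real.exp_pos _).le).trans ?_
  rw [← Real.exp_add]
  refine Real.exp_le_exp.2 ?_
  have h3 : ε / (3 * (L + 1)) * ‖S‖ ≤ ε / 3 * s := by
    calc ε / (3 * (L + 1)) * ‖S‖ ≤ ε / (3 * (L + 1)) * ((L + 1) * s) := by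
          gcongr
          exact hSL.trans (by gcongr; linarith)
      _ = ε / 3 * s := by field_simp
  have h4 : n * (2 * k) ≤ 2 * ε / 3 * s := by
    have h5 : n * (4 * δ) ≤ ε / 3 := by nlinarith
    have h6 : n * (4 * L * (L + δ) * s) ≤ ε / 3 := by
      calc n * (4 * L * (L + δ) * s) ≤ (n + 1) * (4 * (L + 1) * (L + 1) * η) := by
            gcongr <;> linarith
        _ ≤ ε / 3 := by linarith
    calc n * (2 * k) = (n * (4 * δ) + n * (4 * L * (L + δ) * s)) * s := by rw [hk]; ring
      _ ≤ (ε / 3 + ε / 3) * s := by gcongr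
      _ = _ := by ring
  linarith

end VolumeEstimate

/-! ### Confinement to a chart, splitting of the divergence, comparison of densities. -/

section LocalEstimate

variable {d m : ℕ} {M : Type*} [TopologicalSpace M] [T2Space M] [SecondCountableTopology M]
  [ChartedSpace (EuclideanSpace ℝ (Fin d)) M] [IsManifold (𝓡 d) ∞ M]
  [MeasurableSpace M] [BorelSpace M]
  {F : ∀ x : M, EuclideanSpace ℝ (Fin m) → TangentSpace (𝓡 d) x}
  {U : Set (EuclideanSpace ℝ (Fin m))} {w : ℝ → EuclideanSpace ℝ (Fin m)}

lemma intervalIntegrable_comp_curve {H : M × EuclideanSpace ℝ (Fin m) → ℝ} (hH : Continuous H)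
    (hU : IsCompact U) (hw : AEMeasurable w volume) (hwU : ∀ᵐ t, w t ∈ U) {γ : ℝ → M}
    (hγ : Continuous γ) (a b : ℝ) : IntervalIntegrable (fun t => H (γ t, w t)) volume a b := by
  obtain ⟨L, hL⟩ := (((isCompact_uIcc (a := a) (b := b)).image hγ).prod hU).image hH
    |>.isBounded.exists_norm_le
  refine (intervalIntegrable_const (c := L)).mono_fun
    ((hH.measurable.comp_aemeasurable
      (hγ.measurable.aemeasurable.prodMk hw)).aestronglyMeasurable.restrict) ?_
  rw [EventuallyLE, ae_restrict_iff' measurableSet_uIoc]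
  filter_upwards [hwU] with t ht htm
  exact (hL _ (mem_image_of_mem _ ⟨mem_image_of_mem _ (uIoc_subset_uIcc htm), ht⟩)).trans
    (Real.le_norm_self L)

/-- A last-exit argument, run backward from `a`: up to the exit time the velocity is at most `C`, so
less than `R / 2` has been travelled and no exit has occurred. -/
lemma IsTrajectory.mem_ball_of_bound {x : M} {γ : ℝ → M} (hγ : IsTrajectory F w x γ)
    (hwU : ∀ᵐ t, w t ∈ U) (p : M) {c : EuclideanSpace ℝ (Fin d)} {R C : ℝ}
    (hR : Metric.closedBall c R ⊆ (extChartAt (𝓡 d) p).target) (hC0 : 0 ≤ C)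
    (hC : ∀ u ∈ Metric.closedBall c R, ∀ v ∈ U, ‖localRep (fun x => F x v) p u‖ ≤ C)
    {a b : ℝ} (hCs : C * (a - b) < R / 2) (hR0 : 0 < R)
    (ha : γ a ∈ (extChartAt (𝓡 d) p).source)
    (haR : extChartAt (𝓡 d) p (γ a) ∈ Metric.ball c (R / 2)) :
    ∀ t ∈ Icc b a, γ t ∈ (extChartAt (𝓡 d) p).source ∧
      extChartAt (𝓡 d) p (γ t) ∈ Metric.ball c R := by
  set κ := extChartAt (𝓡 d) p with hκ
  set O : Set M := κ.source ∩ κ ⁻¹' Metric.ball c R with hO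
  have hOo : IsOpen O := (continuousOn_extChartAt p).isOpen_inter_preimage
    (isOpen_extChartAt_source p) Metric.isOpen_ball
  -- `K` is compact, hence closed in the Hausdorff space `M`. Therefore the curve lies in the chart
  -- domain at the exit time too, and the integral equation is available up to it.
  set K : Set M := κ.symm '' Metric.closedBall c R with hK
  have hKc : IsClosed K := ((isCompact_closedBall c R).image_of_continuousOn
    ((continuousOn_extChartAt_symm p).mono hR)).isClosed
  have hOK : O ⊆ K := fun q hq => ⟨κ q, Metric.ball_subset_closedBall hq.2, κ.left_inv hq.1⟩
  have hKs : ∀ q ∈ K, q ∈ κ.source ∧ κ q ∈ Metric.closedBall c R := by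
    rintro _ ⟨u, hu, rfl⟩
    exact ⟨κ.map_target (hR hu), by rwa [κ.right_inv (hR hu)]⟩
  by_contra hcon
  push Not at hcon
  obtain ⟨t₁, ht₁, ht₁O⟩ := hcon
  set B : Set ℝ := Icc b a ∩ γ ⁻¹' Oᶜ with hB
  have hBc : IsCompact B := isCompact_Icc.inter_right (hOo.isClosed_compl.preimage hγ.continuous)
  have hBn : B.Nonempty := ⟨t₁, ht₁, fun h => ht₁O h.1 h.2⟩
  have hs := hBc.sSup_mem hBn
  set s := sSup B
  have haO : γ a ∈ O := ⟨ha, Metric.ball_subset_ball (by linarith) haR⟩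
  have hsa : s < a := lt_of_le_of_ne hs.1.2 fun h => hs.2 (by rw [h]; exact haO)
  have hIoc : ∀ t ∈ Ioc s a, γ t ∈ O := by
    intro t ht
    by_contra h
    exact absurd (le_csSup hBc.bddAbove ⟨⟨hs.1.1.trans ht.1.le, ht.2⟩, h⟩) (not_le.2 ht.1)
  have hIcc : ∀ t ∈ Icc s a, γ t ∈ K := by
    have h1 : Icc s a ⊆ γ ⁻¹' K := by
      rw [← closure_Ioc hsa.ne]
      exact closure_minimal (fun t ht => hOK (hIoc t ht)) (hKc.preimage hγ.continuous)
    exact h1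
  have hint := (hγ.integral_localRep p hsa.le fun t ht => (hKs _ (hIcc t ht)).1).2
  have hn : ‖κ (γ a) - κ (γ s)‖ ≤ C * |a - s| := by
    rw [← hint]
    refine intervalIntegral.norm_integral_le_of_norm_le_const_ae ?_
    filter_upwards [hwU] with t ht htm
    rw [uIoc_of_le hsa.le] at htm
    exact hC _ (hKs _ (hIcc t (Ioc_subset_Icc_self htm))).2 _ ht
  rw [abs_of_pos (by linarith)] at hn
  refine hs.2 ⟨(hKs _ (hIcc s (left_mem_Icc.2 hsa.le))).1, ?_⟩
  rw [mem_preimage, Metric.mem_ball, dist_eq_norm]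
  rw [Metric.mem_ball, dist_eq_norm] at haR
  have h1 : C * (a - s) ≤ C * (a - b) := by gcongr; exact hs.1.1
  have h2 : ‖κ (γ s) - c‖ ≤ ‖κ (γ a) - c‖ + ‖κ (γ a) - κ (γ s)‖ := by
    have := norm_sub_le (κ (γ a) - c) (κ (γ a) - κ (γ s))
    simpa using this
  linarith

/-- The product rule separates the divergence into the Euclidean trace, which governs Lebesgue
measure in the chart, and the derivative of the log-density along the field, which governs the
change of density. -/
lemma divergence_eq_trace_add (g : Metric d M)
    (hF : ContMDiff ((𝓡 d).prod 𝓘(ℝ, EuclideanSpace ℝ (Fin m))) (𝓡 d).tangent 1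
      (fun q : M × EuclideanSpace ℝ (Fin m) => (⟨q.1, F q.1 q.2⟩ : TangentBundle (𝓡 d) M)))
    (p : M) (v : EuclideanSpace ℝ (Fin m)) :
    divergence g (fun x => F x v) p =
      traceCLM _ (partialDeriv (fun q : EuclideanSpace ℝ (Fin d) × EuclideanSpace ℝ (Fin m) =>
        localRep (fun x => F x q.2) p q.1) (extChartAt (𝓡 d) p p) v) +
      (density g p (extChartAt (𝓡 d) p p))⁻¹ * fderiv ℝ (density g p) (extChartAt (𝓡 d) p p)
        (localRep (fun x => F x v) p (extChartAt (𝓡 d) p p)) := by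
  set c := extChartAt (𝓡 d) p p
  have hct := mem_extChartAt_target (I := 𝓡 d) p
  have hcn := (isOpen_extChartAt_target (I := 𝓡 d) p).mem_nhds hct
  have h1 : HasFDerivAt (fun q : EuclideanSpace ℝ (Fin d) × EuclideanSpace ℝ (Fin m) =>
        localRep (fun x => F x q.2) p q.1) _ (c, v) :=
    (((contDiffOn_localRep hF p).contDiffAt
      (((isOpen_extChartAt_target p).prod isOpen_univ).mem_nhds
        ⟨hct, mem_univ v⟩)).differentiableAt (by simp)).hasFDerivAt
  have h2 : HasFDerivAt (localRep (fun x => F x v) p) (partialDeriv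
      (fun q : EuclideanSpace ℝ (Fin d) × EuclideanSpace ℝ (Fin m) =>
        localRep (fun x => F x q.2) p q.1) c v) c :=
    h1.comp (f := fun e => (e, v)) c (hasFDerivAt_prodMk_left c v)
  have hpos := density_pos g hct
  rw [divergence, trace_fderiv_smul
    (((contDiffOn_density g p).contDiffAt hcn).differentiableAt (by simp)) h2.differentiableAt,
    h2.fderiv, mul_add, inv_mul_cancel_left₀ hpos.ne']

/-- The change of volume from time `a` back to time `b` along a family of curves, near the member
`i₀` of the family, is at most `exp e`. -/
def BackwardVolumeBound {ι : Type*} (μ : Measure M) (Γ : ι → ℝ → M) (i₀ : ι) (e b a : ℝ) : Prop :=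
  (∀ N' ∈ 𝓝 (Γ i₀ b), ∃ N ∈ 𝓝 (Γ i₀ a), ∀ i, Γ i a ∈ N → Γ i b ∈ N') ∧
  ∃ N ∈ 𝓝 (Γ i₀ a), ∀ A : Set ι, (∀ i ∈ A, Γ i a ∈ N) →
    μ ((fun i => Γ i b) '' A) ≤ ENNReal.ofReal (Real.exp e) * μ ((fun i => Γ i a) '' A)

/-- The continuity clause of `BackwardVolumeBound` exists for this composition: it ensures that
curves close to `Γ i₀` at time `t` are close enough at time `s` for the earlier bound to apply. -/
lemma BackwardVolumeBound.trans {ι : Type*} {μ : Measure M} {Γ : ι → ℝ → M} {i₀ : ι}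
    {e₁ e₂ r s t : ℝ} (h₁ : BackwardVolumeBound μ Γ i₀ e₁ r s)
    (h₂ : BackwardVolumeBound μ Γ i₀ e₂ s t) : BackwardVolumeBound μ Γ i₀ (e₁ + e₂) r t := by
  obtain ⟨hc₁, N₁, hN₁, hv₁⟩ := h₁
  obtain ⟨hc₂, N₂, hN₂, hv₂⟩ := h₂
  refine ⟨fun N' hN' => ?_, ?_⟩
  · obtain ⟨N, hN, h⟩ := hc₁ N' hN'
    obtain ⟨N'', hN'', h'⟩ := hc₂ N hN
    exact ⟨N'', hN'', fun i hi => h i (h' i hi)⟩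
  · obtain ⟨N, hN, h⟩ := hc₂ N₁ hN₁
    refine ⟨N ∩ N₂, inter_mem hN hN₂, fun A hA => ?_⟩
    refine (hv₁ A fun i hi => h i (hA i hi).1).trans ?_
    rw [Real.exp_add, ENNReal.ofReal_mul (Real.exp_pos _).le, mul_assoc]
    gcongr
    exact hv₂ A fun i hi => (hA i hi).2

/-- Comparison of the densities at two points on a trajectory near `p`. -/
lemma exists_log_density_estimate (g : Metric d M)
    (hF : ContMDiff ((𝓡 d).prod 𝓘(ℝ, EuclideanSpace ℝ (Fin m))) (𝓡 d).tangent 1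
      (fun q : M × EuclideanSpace ℝ (Fin m) => (⟨q.1, F q.1 q.2⟩ : TangentBundle (𝓡 d) M)))
    (hU : IsCompact U) (p : M) {ε : ℝ} (hε : 0 < ε) :
    ∃ R > 0, ∃ C ≥ 0, Metric.closedBall (extChartAt (𝓡 d) p p) R ⊆ (extChartAt (𝓡 d) p).target ∧
      (∀ u ∈ Metric.closedBall (extChartAt (𝓡 d) p p) R, ∀ v ∈ U,
        ‖localRep (fun x => F x v) p u‖ ≤ C) ∧
      ∀ (w : ℝ → EuclideanSpace ℝ (Fin m)), AEMeasurable w volume → (∀ᵐ t, w t ∈ U) →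
      ∀ (x : M) (γ : ℝ → M), IsTrajectory F w x γ → ∀ a b : ℝ, b ≤ a →
        (∀ t ∈ Icc b a, γ t ∈ (extChartAt (𝓡 d) p).source ∧
          extChartAt (𝓡 d) p (γ t) ∈ Metric.closedBall (extChartAt (𝓡 d) p p) R) →
        Real.log (density g p (extChartAt (𝓡 d) p (γ b))) -
          Real.log (density g p (extChartAt (𝓡 d) p (γ a))) ≤
        -(∫ r in b..a, (density g p (extChartAt (𝓡 d) p p))⁻¹ *
          fderiv ℝ (density g p) (extChartAt (𝓡 d) p p)
            (localRep (fun x => F x (w r)) p (extChartAt (𝓡 d) p p))) + ε * (a - b) := by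
  set κ := extChartAt (𝓡 d) p with hκ
  set c := κ p with hc
  set f : EuclideanSpace ℝ (Fin d) × EuclideanSpace ℝ (Fin m) → EuclideanSpace ℝ (Fin d) :=
    fun q => localRep (fun x => F x q.2) p q.1 with hf
  have hct : c ∈ κ.target := mem_extChartAt_target (I := 𝓡 d) p
  have hto : IsOpen κ.target := isOpen_extChartAt_target (I := 𝓡 d) p
  have hfd : ContDiffOn ℝ 1 f (κ.target ×ˢ univ) := contDiffOn_localRep hF p
  have hfc : Continuous fun v => f (c, v) :=
    hfd.continuousOn.comp_continuous (f := fun v => (c, v)) (by fun_prop)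
      fun v => ⟨hct, mem_univ v⟩
  obtain ⟨C₀, hC₀⟩ := (hU.image hfc).isBounded.exists_norm_le
  set C := max C₀ 0 + 1 with hC
  have hCpos : 0 < C := by positivity
  set ℓ' : EuclideanSpace ℝ (Fin d) →L[ℝ] ℝ := (density g p c)⁻¹ • fderiv ℝ (density g p) c with hℓ'
  -- Strict differentiability is needed because the two endpoints compared are both near `c`, and
  -- neither need be `c`.
  have hρ : HasStrictFDerivAt (density g p) (fderiv ℝ (density g p) c) c :=
    ((contDiffOn_density g p).contDiffAt (hto.mem_nhds hct)).hasStrictFDerivAt (by simp)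
  have hℓ : HasStrictFDerivAt (fun u => Real.log (density g p u)) ℓ' c :=
    hρ.log (density_pos g hct).ne'
  set ε₂ := min 1 (ε / (2 * (‖ℓ'‖ + 1))) with hε₂
  have hε₂0 : 0 < ε₂ := lt_min one_pos (by positivity)
  have hε₂2 : ‖ℓ'‖ * ε₂ ≤ ε / 2 := by
    calc ‖ℓ'‖ * ε₂ ≤ (‖ℓ'‖ + 1) * (ε / (2 * (‖ℓ'‖ + 1))) := by
          gcongr
          · linarith
          · exact min_le_right _ _
      _ = ε / 2 := by field_simp
  have hev1 : ∀ᶠ u in 𝓝 c, ∀ v ∈ U, ‖f (u, v) - f (c, v)‖ ≤ ε₂ := by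
    refine hU.eventually_forall_of_forall_eventually fun v _ => ?_
    have h1 : ContinuousAt (fun q : EuclideanSpace ℝ (Fin d) × EuclideanSpace ℝ (Fin m) =>
        f q - f (c, q.2)) (c, v) :=
      (hfd.continuousOn.continuousAt ((hto.prod isOpen_univ).mem_nhds ⟨hct, mem_univ v⟩)).sub
        (hfc.continuousAt.comp continuousAt_snd)
    have h2 : ∀ᶠ q in 𝓝 (c, v), ‖f q - f (c, q.2)‖ < ε₂ := by
      refine h1.norm.eventually (gt_mem_nhds ?_)
      simpa using hε₂0
    exact h2.mono fun q hq => hq.le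
  have hev2 := hℓ.isLittleO.def (show 0 < ε / (2 * C) by positivity)
  rw [nhds_prod_eq] at hev2
  obtain ⟨S, hS, hS2⟩ := (eventually_prod_self_iff (r := fun u v =>
    ‖Real.log (density g p u) - Real.log (density g p v) - ℓ' (u - v)‖ ≤
      ε / (2 * C) * ‖u - v‖)).1 hev2
  obtain ⟨R₁, hR₁, hball⟩ := Metric.eventually_nhds_iff.1
    (hev1.and ((eventually_of_mem (hto.mem_nhds hct) fun u hu => hu).and
      (eventually_of_mem hS fun u hu => hu)))
  have hmem : ∀ u ∈ Metric.closedBall c (R₁ / 2), dist u c < R₁ := by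
    intro u hu
    have := Metric.mem_closedBall.1 hu
    linarith
  have hbound : ∀ u ∈ Metric.closedBall c (R₁ / 2), ∀ v ∈ U, ‖f (u, v)‖ ≤ C := by
    intro u hu v hv
    have h1 := (hball (hmem u hu)).1 v hv
    have h2 : ‖f (c, v)‖ ≤ C₀ := hC₀ _ (mem_image_of_mem _ hv)
    have h3 : ‖f (u, v)‖ ≤ ‖f (u, v) - f (c, v)‖ + ‖f (c, v)‖ := by
      simpa using norm_add_le (f (u, v) - f (c, v)) (f (c, v))
    have h4 : ε₂ ≤ 1 := min_le_left _ _
    have h5 := le_max_left C₀ 0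
    linarith
  refine ⟨R₁ / 2, by positivity, C, hCpos.le, fun u hu => (hball (hmem u hu)).2.1, hbound,
    fun w hw hwU x γ hγ a b hba hγR => ?_⟩
  obtain ⟨hint, hval⟩ := hγ.integral_localRep p hba fun t ht => (hγR t ht).1
  have hs0 : 0 ≤ a - b := by linarith
  have hwc : IntervalIntegrable (fun r => ℓ' (f (c, w r))) volume b a :=
    intervalIntegrable_comp_of_isCompact (D := fun v => ℓ' (f (c, v)))
      (ℓ'.continuous.comp hfc) hU hw hwU b a
  have hint' : IntervalIntegrable (fun r => ℓ' (f (κ (γ r), w r))) volume b a :=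
    ⟨ℓ'.integrable_comp hint.1, ℓ'.integrable_comp hint.2⟩
  have hval' : ∫ r in b..a, ℓ' (f (κ (γ r), w r)) = ℓ' (κ (γ a) - κ (γ b)) := by
    rw [← hval]; exact ℓ'.intervalIntegral_comp_comm hint
  have hn : ‖κ (γ a) - κ (γ b)‖ ≤ C * (a - b) := by
    rw [← hval]
    have : ‖∫ r in b..a, f (κ (γ r), w r)‖ ≤ C * |a - b| := by
      refine intervalIntegral.norm_integral_le_of_norm_le_const_ae ?_
      filter_upwards [hwU] with t ht htm
      rw [uIoc_of_le hba] at htm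
      exact hbound _ (hγR t (Ioc_subset_Icc_self htm)).2 _ ht
    rwa [abs_of_nonneg hs0] at this
  have h1 : |(∫ r in b..a, ℓ' (f (κ (γ r), w r))) - ∫ r in b..a, ℓ' (f (c, w r))| ≤
      ε / 2 * (a - b) := by
    rw [← intervalIntegral.integral_sub hint' hwc, ← Real.norm_eq_abs]
    have : ‖∫ r in b..a, (ℓ' (f (κ (γ r), w r)) - ℓ' (f (c, w r)))‖ ≤ ε / 2 * |a - b| := by
      refine intervalIntegral.norm_integral_le_of_norm_le_const_ae ?_
      filter_upwards [hwU] with t ht htm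
      rw [uIoc_of_le hba] at htm
      rw [← map_sub]
      refine (ℓ'.le_opNorm _).trans (le_trans ?_ hε₂2)
      gcongr
      exact (hball (hmem _ (hγR t (Ioc_subset_Icc_self htm)).2)).1 _ ht
    rwa [abs_of_nonneg hs0] at this
  have h2 := hS2 _ (hball (hmem _ (hγR a (right_mem_Icc.2 hba)).2)).2.2 _
    (hball (hmem _ (hγR b (left_mem_Icc.2 hba)).2)).2.2
  have h3 : ε / (2 * C) * ‖κ (γ a) - κ (γ b)‖ ≤ ε / 2 * (a - b) := by
    calc ε / (2 * C) * ‖κ (γ a) - κ (γ b)‖ ≤ ε / (2 * C) * (C * (a - b)) := by gcongr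
      _ = ε / 2 * (a - b) := by field_simp
  rw [hval'] at h1
  rw [Real.norm_eq_abs] at h2
  have h4 := (abs_le.1 (h2.trans h3)).1
  have h5 := (abs_le.1 h1).1
  have h6 : ∫ r in b..a, (density g p c)⁻¹ * fderiv ℝ (density g p) c
      (localRep (fun x => F x (w r)) p c) = ∫ r in b..a, ℓ' (f (c, w r)) := rfl
  rw [h6]
  linarith

end LocalEstimate

/-! ### Liouville's inequality for the Riemannian volume. -/

section GlobalEstimate

variable {d m : ℕ} {M : Type*} [TopologicalSpace M] [T2Space M] [SecondCountableTopology M]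
  [ChartedSpace (EuclideanSpace ℝ (Fin d)) M] [IsManifold (𝓡 d) ∞ M]
  [MeasurableSpace M] [BorelSpace M]
  {F : ∀ x : M, EuclideanSpace ℝ (Fin m) → TangentSpace (𝓡 d) x}
  {U : Set (EuclideanSpace ℝ (Fin m))} {w : ℝ → EuclideanSpace ℝ (Fin m)}

lemma BackwardVolumeBound.refl {ι : Type*} (μ : Measure M) (Γ : ι → ℝ → M) (i₀ : ι) (a : ℝ) :
    BackwardVolumeBound μ Γ i₀ 0 a a :=
  ⟨fun N' hN' => ⟨N', hN', fun _ h => h⟩, univ, univ_mem, fun A _ => by simp⟩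

/-- The volume of a set near a point of a chart domain is almost the density at that point times
the Lebesgue measure. -/
lemma exists_nhds_volume_bounds (g : Metric d M) (p : M) {q : M}
    (hq : q ∈ (extChartAt (𝓡 d) p).source) {θ : ℝ} (hθ : 0 < θ) :
    ∃ N ∈ 𝓝 q, ∀ B ⊆ N,
      riemannianVolume g B ≤ ENNReal.ofReal
        (Real.exp (Real.log (density g p (extChartAt (𝓡 d) p q)) + θ)) *
          volume (extChartAt (𝓡 d) p '' B) ∧
      ENNReal.ofReal (Real.exp (Real.log (density g p (extChartAt (𝓡 d) p q)) - θ)) *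
          volume (extChartAt (𝓡 d) p '' B) ≤ riemannianVolume g B := by
  set κ := extChartAt (𝓡 d) p
  have hqt := κ.map_source hq
  have hρ : ContinuousAt (fun q' => Real.log (density g p (κ q'))) q := by
    refine ContinuousAt.log ?_ (density_pos g hqt).ne'
    exact ContinuousAt.comp (g := density g p)
      ((contDiffOn_density g p).continuousOn.continuousAt
        ((isOpen_extChartAt_target p).mem_nhds hqt)) (continuousAt_extChartAt' hq)
  refine ⟨κ.source ∩ {q' | |Real.log (density g p (κ q')) - Real.log (density g p (κ q))| < θ},
    inter_mem ((isOpen_extChartAt_source p).mem_nhds hq) ?_, fun B hB => ⟨?_, ?_⟩⟩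
  · have := Metric.tendsto_nhds.1 hρ θ hθ
    simp only [Real.dist_eq] at this
    exact this
  · refine riemannianVolume_le g p (fun q' h => (hB h).1) fun q' h => ?_
    have h0 : |Real.log (density g p (κ q')) - Real.log (density g p (κ q))| < θ := (hB h).2
    have h1 := (abs_lt.1 h0).2
    rw [← Real.log_le_iff_le_exp (density_pos g (κ.map_source (hB h).1))]
    linarith
  · refine le_riemannianVolume g p (fun q' h => (hB h).1) fun q' h => ?_
    have h0 : |Real.log (density g p (κ q')) - Real.log (density g p (κ q))| < θ := (hB h).2
    have h1 := (abs_lt.1 h0).1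
    rw [← Real.le_log_iff_exp_le (density_pos g (κ.map_source (hB h).1))]
    linarith

/-- In the chart at `Γ i₀ t₀`, Riemannian volume is traded for density times Lebesgue measure at
both end times. The Lebesgue distortion and the change of log-density then recombine to the
divergence at the centre, which is close to the divergence along `Γ i₀`. -/
lemma exists_local_backwardVolumeBound (g : Metric d M)
    (hF : ContMDiff ((𝓡 d).prod 𝓘(ℝ, EuclideanSpace ℝ (Fin m))) (𝓡 d).tangent 1
      (fun q : M × EuclideanSpace ℝ (Fin m) => (⟨q.1, F q.1 q.2⟩ : TangentBundle (𝓡 d) M)))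
    (hU : IsCompact U) (hw : AEMeasurable w volume) (hwU : ∀ᵐ t, w t ∈ U)
    {ι : Type*} {x : ι → M} {Γ : ι → ℝ → M} (hΓ : ∀ i, IsTrajectory F w (x i) (Γ i)) (i₀ : ι)
    (t₀ : ℝ) {ε : ℝ} (hε : 0 < ε) :
    ∃ η > 0, ∀ b a, b ∈ Icc (t₀ - η) (t₀ + η) → a ∈ Icc (t₀ - η) (t₀ + η) → b ≤ a →
      BackwardVolumeBound (riemannianVolume g) Γ i₀
        (-(∫ r in b..a, divergence g (fun q => F q (w r)) (Γ i₀ r)) + ε * (a - b)) b a := by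
  set p := Γ i₀ t₀ with hp
  set κ := extChartAt (𝓡 d) p with hκ
  set c := κ p with hc
  set f : EuclideanSpace ℝ (Fin d) × EuclideanSpace ℝ (Fin m) → EuclideanSpace ℝ (Fin d) :=
    fun q => localRep (fun x => F x q.2) p q.1 with hf
  have hct : c ∈ κ.target := mem_extChartAt_target (I := 𝓡 d) p
  have hto : IsOpen κ.target := isOpen_extChartAt_target (I := 𝓡 d) p
  have hso : IsOpen κ.source := isOpen_extChartAt_source (I := 𝓡 d) p
  have hfd : ContDiffOn ℝ 1 f (κ.target ×ˢ univ) := contDiffOn_localRep hF p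
  have hfc : Continuous fun v => f (c, v) :=
    hfd.continuousOn.comp_continuous (f := fun v => (c, v)) (by fun_prop)
      fun v => ⟨hct, mem_univ v⟩
  -- Five errors of size `ε' * (a - b)` occur: the Lebesgue distortion, the log-density, the
  -- variation of the divergence, and one volume comparison at each end; one sixth is spare.
  set ε' := ε / 6 with hε'
  have hε'0 : 0 < ε' := by positivity
  obtain ⟨R₁, hR₁, η₁, hη₁, -, hvol⟩ := exists_local_volume_estimate hto hfd hct hU hε'0
  obtain ⟨R₂, hR₂, C, hC0, hR₂t, hC, hlog⟩ := exists_log_density_estimate g hF hU p hε'0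
  have hdivc := continuous_divergence g hF
  have hdiv : ∀ᶠ q in 𝓝 p, ∀ v ∈ U,
      |divergence g (fun x => F x v) q - divergence g (fun x => F x v) p| ≤ ε' := by
    refine hU.eventually_forall_of_forall_eventually fun v _ => ?_
    have h1 : Continuous fun q : M × EuclideanSpace ℝ (Fin m) =>
        |divergence g (fun x => F x q.2) q.1 - divergence g (fun x => F x q.2) p| :=
      (hdivc.sub (hdivc.comp (by fun_prop : Continuous fun q : M × EuclideanSpace ℝ (Fin m) =>
        (p, q.2)))).abs
    have h2 : ∀ᶠ q : M × EuclideanSpace ℝ (Fin m) in 𝓝 (p, v),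
        |divergence g (fun x => F x q.2) q.1 - divergence g (fun x => F x q.2) p| < ε' :=
      (h1.tendsto (p, v)).eventually (gt_mem_nhds (by simpa using hε'0))
    exact h2.mono fun q hq => hq.le
  set R := min R₁ R₂ with hR
  have hR0 : 0 < R := lt_min hR₁ hR₂
  have hRR₁ : Metric.closedBall c R ⊆ Metric.closedBall c R₁ :=
    Metric.closedBall_subset_closedBall (min_le_left _ _)
  have hRR₂ : Metric.closedBall c R ⊆ Metric.closedBall c R₂ :=
    Metric.closedBall_subset_closedBall (min_le_right _ _)
  set O : Set M := κ.source ∩ κ ⁻¹' Metric.ball c (R / 2) with hO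
  have hOo : IsOpen O := (continuousOn_extChartAt p).isOpen_inter_preimage hso Metric.isOpen_ball
  have hpO : p ∈ O := ⟨mem_extChartAt_source p, Metric.mem_ball_self (by positivity)⟩
  have hev := ((hΓ i₀).continuous.tendsto t₀).eventually
    (hdiv.and (hOo.mem_nhds hpO))
  obtain ⟨η₂, hη₂, hball⟩ := Metric.eventually_nhds_iff.1 hev
  set η := min (η₂ / 2) (min (η₁ / 2) (R / (8 * (C + 1)))) with hη
  have hη0 : 0 < η := lt_min (by positivity) (lt_min (by positivity) (by positivity))
  have hη2 : η ≤ η₂ / 2 := min_le_left _ _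
  have hη1 : η ≤ η₁ / 2 := (min_le_right _ _).trans (min_le_left _ _)
  have hη3 : η * (8 * (C + 1)) ≤ R := by
    rw [← le_div_iff₀ (by positivity)]; exact (min_le_right _ _).trans (min_le_right _ _)
  refine ⟨η, hη0, fun b a hb ha hba => ?_⟩
  -- The tolerance `θ` in the volume comparisons is proportional to `a - b` and must be positive, so
  -- the degenerate interval is treated apart.
  rcases hba.eq_or_lt with rfl | hlt
  · simpa using BackwardVolumeBound.refl (riemannianVolume g) Γ i₀ b
  have hs0 : 0 < a - b := by linarith
  have hs1 : a - b ≤ 2 * η := by linarith [hb.1, ha.2]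
  have hCs : C * (a - b) < R / 2 := by
    have : C * (a - b) ≤ C * (2 * η) := by gcongr
    nlinarith
  have hnear : ∀ t ∈ Icc b a, (∀ v ∈ U, |divergence g (fun x => F x v) (Γ i₀ t) -
      divergence g (fun x => F x v) p| ≤ ε') ∧ Γ i₀ t ∈ O := by
    intro t ht
    refine hball ?_
    rw [Real.dist_eq, abs_lt]
    constructor <;> linarith [hb.1, ha.2, ht.1, ht.2]
  have hstay : ∀ i, Γ i a ∈ O → ∀ t ∈ Icc b a, Γ i t ∈ κ.source ∧ κ (Γ i t) ∈ Metric.ball c R :=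
    fun i hi => (hΓ i).mem_ball_of_bound hwU p (hRR₂.trans hR₂t) hC0
      (fun u hu => hC u (hRR₂ hu)) hCs hR0 hi.1 hi.2
  have hi₀ : Γ i₀ a ∈ O := (hnear a (right_mem_Icc.2 hba)).2
  have hest := fun (A : Set ι) (hA : ∀ i ∈ A, Γ i a ∈ O) =>
    hvol w hw hwU a b hba (by linarith) (fun i t => κ (Γ i t)) A
    (fun i hi => (continuousOn_extChartAt p).comp (hΓ i).continuous.continuousOn
      fun t ht => (hstay i (hA i hi) t ht).1)
    (fun i hi t ht => hRR₁ (Metric.ball_subset_closedBall (hstay i (hA i hi) t ht).2))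
    (fun i hi t ht => (hΓ i).integral_localRep p ht.2 fun r hr =>
      (hstay i (hA i hi) r ⟨ht.1.trans hr.1, hr.2⟩).1)
  have hcont : ∀ N' ∈ 𝓝 (Γ i₀ b), ∃ N ∈ 𝓝 (Γ i₀ a), ∀ i, Γ i a ∈ N → Γ i b ∈ N' := by
    intro N' hN'
    have hbs := (hstay i₀ hi₀ b (left_mem_Icc.2 hba)).1
    have has := (hstay i₀ hi₀ a (right_mem_Icc.2 hba)).1
    have h1 : κ.symm ⁻¹' N' ∈ 𝓝 (κ (Γ i₀ b)) := by
      refine (continuousAt_extChartAt_symm' hbs).preimage_mem_nhds ?_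
      rwa [κ.left_inv hbs]
    obtain ⟨r, hr, hrb⟩ := Metric.mem_nhds_iff.1 h1
    refine ⟨O ∩ κ ⁻¹' Metric.ball (κ (Γ i₀ a)) (r / 2), inter_mem (hOo.mem_nhds hi₀)
      ((continuousAt_extChartAt' has).preimage_mem_nhds
        (Metric.ball_mem_nhds _ (by positivity))), fun i hi => ?_⟩
    have h2 := (hest {j | Γ j a ∈ O} fun j hj => hj).1 i hi.1 i₀ hi₀ b (left_mem_Icc.2 hba)
    have h3 := hi.2
    rw [mem_preimage, Metric.mem_ball, dist_eq_norm] at h3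
    have h4 : κ (Γ i b) ∈ Metric.ball (κ (Γ i₀ b)) r := by
      rw [Metric.mem_ball, dist_eq_norm]; linarith
    have h5 := hrb h4
    rwa [mem_preimage, κ.left_inv (hstay i hi.1 b (left_mem_Icc.2 hba)).1] at h5
  refine ⟨hcont, ?_⟩
  set θ := ε' * (a - b) with hθ
  have hθ0 : 0 < θ := by positivity
  obtain ⟨Na, hNa, hva⟩ := exists_nhds_volume_bounds g p
    (hstay i₀ hi₀ a (right_mem_Icc.2 hba)).1 hθ0
  obtain ⟨Nb, hNb, hvb⟩ := exists_nhds_volume_bounds g p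
    (hstay i₀ hi₀ b (left_mem_Icc.2 hba)).1 hθ0
  obtain ⟨N₁, hN₁, hN₁b⟩ := hcont Nb hNb
  refine ⟨O ∩ (Na ∩ N₁), inter_mem (hOo.mem_nhds hi₀) (inter_mem hNa hN₁), fun A hA => ?_⟩
  have h1 := (hvb ((fun i => Γ i b) '' A) (by
    rintro _ ⟨i, hi, rfl⟩; exact hN₁b i (hA i hi).2.2)).1
  have h2 := (hva ((fun i => Γ i a) '' A) (by
    rintro _ ⟨i, hi, rfl⟩; exact (hA i hi).2.1)).2
  have h3 := (hest A fun i hi => (hA i hi).1).2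
  rw [image_image] at h1 h2
  set lb := Real.log (density g p (κ (Γ i₀ b)))
  set la := Real.log (density g p (κ (Γ i₀ a)))
  set e₁ := -(∫ r in b..a, traceCLM (EuclideanSpace ℝ (Fin d)) (partialDeriv f c (w r))) +
    ε' * (a - b) with he₁
  set e := -(∫ r in b..a, divergence g (fun q => F q (w r)) (Γ i₀ r)) + ε * (a - b) with he
  have hexp : lb + θ + e₁ ≤ e + (la - θ) := by
    have h4 := hlog w hw hwU (x i₀) (Γ i₀) (hΓ i₀) a b hba fun t ht =>
      ⟨(hstay i₀ hi₀ t ht).1, hRR₂ (Metric.ball_subset_closedBall (hstay i₀ hi₀ t ht).2)⟩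
    set ℓ' : EuclideanSpace ℝ (Fin d) →L[ℝ] ℝ := fderiv ℝ (density g p) c
    have hi1 : IntervalIntegrable (fun r => traceCLM (EuclideanSpace ℝ (Fin d))
        (partialDeriv f c (w r))) volume b a :=
      intervalIntegrable_comp_of_isCompact (D := fun v => traceCLM (EuclideanSpace ℝ (Fin d))
        (partialDeriv f c v)) ((traceCLM _).continuous.comp
          (continuous_partialDeriv hto hfd hct)) hU hw hwU b a
    have hi2 : IntervalIntegrable (fun r => (density g p c)⁻¹ * ℓ' (f (c, w r))) volume b a :=
      intervalIntegrable_comp_of_isCompact (D := fun v => (density g p c)⁻¹ * ℓ' (f (c, v)))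
        (continuous_const.mul (ℓ'.continuous.comp hfc)) hU hw hwU b a
    have h5 : ∫ r in b..a, divergence g (fun q => F q (w r)) p =
        (∫ r in b..a, traceCLM (EuclideanSpace ℝ (Fin d)) (partialDeriv f c (w r))) +
        ∫ r in b..a, (density g p c)⁻¹ * ℓ' (f (c, w r)) := by
      rw [← intervalIntegral.integral_add hi1 hi2]
      refine intervalIntegral.integral_congr fun r _ => ?_
      exact divergence_eq_trace_add g hF p (w r)
    have h6 : |(∫ r in b..a, divergence g (fun q => F q (w r)) (Γ i₀ r)) -
        ∫ r in b..a, divergence g (fun q => F q (w r)) p| ≤ ε' * (a - b) := by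
      rw [← intervalIntegral.integral_sub
        (intervalIntegrable_comp_curve hdivc hU hw hwU (hΓ i₀).continuous b a)
        (intervalIntegrable_comp_curve hdivc hU hw hwU (continuous_const (y := p)) b a),
        ← Real.norm_eq_abs, ← abs_of_pos hs0]
      refine intervalIntegral.norm_integral_le_of_norm_le_const_ae ?_
      filter_upwards [hwU] with t ht htm
      rw [uIoc_of_le hba] at htm
      exact (hnear t (Ioc_subset_Icc_self htm)).1 _ ht
    have h7 := (abs_le.1 h6).2
    have h8 : lb - la ≤ -(∫ r in b..a, (density g p c)⁻¹ * ℓ' (f (c, w r))) + ε' * (a - b) := h4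
    have h9 : ε * (a - b) = 6 * θ := by rw [hθ, hε']; ring
    rw [he, he₁, h9]
    linarith
  have hcomb : ENNReal.ofReal (Real.exp (lb + θ)) * ENNReal.ofReal (Real.exp e₁) ≤
      ENNReal.ofReal (Real.exp e) * ENNReal.ofReal (Real.exp (la - θ)) := by
    rw [← ENNReal.ofReal_mul (Real.exp_pos _).le, ← ENNReal.ofReal_mul (Real.exp_pos _).le,
      ← Real.exp_add, ← Real.exp_add]
    exact ENNReal.ofReal_le_ofReal (Real.exp_le_exp.2 hexp)
  calc riemannianVolume g ((fun i => Γ i b) '' A)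
      ≤ ENNReal.ofReal (Real.exp (lb + θ)) * volume ((fun i => κ (Γ i b)) '' A) := h1
    _ ≤ ENNReal.ofReal (Real.exp (lb + θ)) * (ENNReal.ofReal (Real.exp e₁) *
        volume ((fun i => κ (Γ i a)) '' A)) := by gcongr
    _ ≤ ENNReal.ofReal (Real.exp e) * ENNReal.ofReal (Real.exp (la - θ)) *
        volume ((fun i => κ (Γ i a)) '' A) := by
        rw [← mul_assoc]; gcongr
    _ ≤ _ := by
        rw [mul_assoc]; gcongr

/-- The exponent is additive over adjacent intervals and the bounds compose, so the local statement
propagates to any compact interval. -/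
lemma backwardVolumeBound (g : Metric d M)
    (hF : ContMDiff ((𝓡 d).prod 𝓘(ℝ, EuclideanSpace ℝ (Fin m))) (𝓡 d).tangent 1
      (fun q : M × EuclideanSpace ℝ (Fin m) => (⟨q.1, F q.1 q.2⟩ : TangentBundle (𝓡 d) M)))
    (hU : IsCompact U) (hw : AEMeasurable w volume) (hwU : ∀ᵐ t, w t ∈ U)
    {ι : Type*} {x : ι → M} {Γ : ι → ℝ → M} (hΓ : ∀ i, IsTrajectory F w (x i) (Γ i)) (i₀ : ι)
    {ε : ℝ} (hε : 0 < ε) {b a : ℝ} (hba : b ≤ a) :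
    BackwardVolumeBound (riemannianVolume g) Γ i₀
      (-(∫ r in b..a, divergence g (fun q => F q (w r)) (Γ i₀ r)) + ε * (a - b)) b a := by
  have hint := intervalIntegrable_comp_curve (continuous_divergence g hF) hU hw hwU
    (hΓ i₀).continuous
  refine rel_of_local (a := b) (b := a) (fun b a => BackwardVolumeBound (riemannianVolume g) Γ i₀
      (-(∫ r in b..a, divergence g (fun q => F q (w r)) (Γ i₀ r)) + ε * (a - b)) b a)
      ?_ ?_ le_rfl hba le_rfl
  · rintro r s t - - - - h₁ h₂
    convert h₁.trans h₂ using 1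
    rw [← intervalIntegral.integral_add_adjacent_intervals (hint r s) (hint s t)]
    ring
  · intro t₀ _
    obtain ⟨η, hη, h⟩ := exists_local_backwardVolumeBound g hF hU hw hwU hΓ i₀ t₀ hε
    exact ⟨η, hη, fun s t _ _ hs ht hst => h s t hs ht hst⟩

/-- If the integral of the divergence along all trajectories of a family is at least `β`, then the
volume grows at least by the factor `exp β`. -/
lemma riemannianVolume_image_le (g : Metric d M)
    (hF : ContMDiff ((𝓡 d).prod 𝓘(ℝ, EuclideanSpace ℝ (Fin m))) (𝓡 d).tangent 1
      (fun q : M × EuclideanSpace ℝ (Fin m) => (⟨q.1, F q.1 q.2⟩ : TangentBundle (𝓡 d) M)))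
    (hU : IsCompact U) (hw : AEMeasurable w volume) (hwU : ∀ᵐ t, w t ∈ U)
    {ι : Type*} {x : ι → M} {Γ : ι → ℝ → M} (hΓ : ∀ i, IsTrajectory F w (x i) (Γ i))
    {b a : ℝ} (hba : b ≤ a) {A : Set ι} {β : ℝ}
    (hβ : ∀ i ∈ A, β ≤ ∫ r in b..a, divergence g (fun q => F q (w r)) (Γ i r)) :
    riemannianVolume g ((fun i => Γ i b) '' A) ≤
      ENNReal.ofReal (Real.exp (-β)) * riemannianVolume g ((fun i => Γ i a) '' A) := by
  set μ := riemannianVolume g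
  have hε : ∀ ε : ℝ, 0 < ε → μ ((fun i => Γ i b) '' A) ≤
      ENNReal.ofReal (Real.exp (-β + ε * (a - b))) * μ ((fun i => Γ i a) '' A) := by
    intro ε hε
    choose N hN hNv using fun i => (backwardVolumeBound g hF hU hw hwU hΓ i hε hba).2
    set B : Set M := (fun i => Γ i a) '' A with hB
    -- The bound holds only near each individual curve; by the Lindelöf property countably many of
    -- these neighbourhoods suffice.
    obtain ⟨J, hJA, hJc, hJ⟩ := TopologicalSpace.isOpen_biUnion_countable A
      (fun i => interior (N i)) fun _ _ => isOpen_interior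
    by_cases hAe : A = ∅
    · simp [hAe]
    have hAJ : ∀ i ∈ A, ∃ j ∈ J, Γ i a ∈ interior (N j) := by
      intro i hi
      have h1 : Γ i a ∈ ⋃ i ∈ A, interior (N i) :=
        mem_biUnion hi (mem_interior_iff_mem_nhds.2 (hN i))
      rw [← hJ] at h1
      simpa using h1
    have hJn : J.Nonempty := by
      obtain ⟨i, hi⟩ := nonempty_iff_ne_empty.2 hAe
      obtain ⟨j, hj, -⟩ := hAJ i hi
      exact ⟨j, hj⟩
    obtain ⟨s, hs⟩ := hJc.exists_eq_range hJn
    -- Disjoint measurable pieces at time `a` let their volumes sum to at most that of `B`, via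
    -- `μ.restrict B`, although `B` may be nonmeasurable. At time `b` countable subadditivity is
    -- enough.
    set W : ℕ → Set M := disjointed fun n => interior (N (s n)) with hW
    have hWm : ∀ n, MeasurableSet (W n) := fun n =>
      MeasurableSet.disjointed (fun _ => isOpen_interior.measurableSet) n
    have hWd : Pairwise (Function.onFun Disjoint W) := disjoint_disjointed _
    have hcov : ∀ i ∈ A, ∃ n, Γ i a ∈ W n := by
      intro i hi
      obtain ⟨j, hj, hij⟩ := hAJ i hi
      rw [hs] at hj
      obtain ⟨n, rfl⟩ := hj
      have : Γ i a ∈ ⋃ n, W n := by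
        rw [hW, iUnion_disjointed]; exact mem_iUnion.2 ⟨n, hij⟩
      exact mem_iUnion.1 this
    set A' : ℕ → Set ι := fun n => {i ∈ A | Γ i a ∈ W n}
    have hpiece : ∀ n, μ ((fun i => Γ i b) '' A' n) ≤
        ENNReal.ofReal (Real.exp (-β + ε * (a - b))) * μ (W n ∩ B) := by
      intro n
      have hsn : s n ∈ A := hJA (hs ▸ mem_range_self n)
      refine (hNv (s n) (A' n) fun i hi =>
        interior_subset (disjointed_subset (fun n => interior (N (s n))) n hi.2)).trans ?_
      gcongr
      · exact hβ _ hsn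
      · rintro _ ⟨i, hi, rfl⟩
        exact ⟨hi.2, mem_image_of_mem _ hi.1⟩
    have hAU : (fun i => Γ i b) '' A ⊆ ⋃ n, (fun i => Γ i b) '' A' n := by
      rintro _ ⟨i, hi, rfl⟩
      obtain ⟨n, hn⟩ := hcov i hi
      exact mem_iUnion.2 ⟨n, i, ⟨hi, hn⟩, rfl⟩
    calc μ ((fun i => Γ i b) '' A) ≤ ∑' n, μ ((fun i => Γ i b) '' A' n) :=
          (measure_mono hAU).trans (measure_iUnion_le _)
      _ ≤ ∑' n, ENNReal.ofReal (Real.exp (-β + ε * (a - b))) * μ (W n ∩ B) :=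
          ENNReal.tsum_le_tsum hpiece
      _ = ENNReal.ofReal (Real.exp (-β + ε * (a - b))) * ∑' n, μ.restrict B (W n) := by
          rw [ENNReal.tsum_mul_left]
          congr 1
          exact tsum_congr fun n => (Measure.restrict_apply (hWm n)).symm
      _ = ENNReal.ofReal (Real.exp (-β + ε * (a - b))) * μ.restrict B (⋃ n, W n) := by
          rw [measure_iUnion hWd hWm]
      _ ≤ _ := by
          exact mul_le_mul' le_rfl
            ((measure_mono (subset_univ _)).trans (Measure.restrict_apply_univ (μ := μ) B).le)
  have hlim : Tendsto (fun ε : ℝ => ENNReal.ofReal (Real.exp (-β + ε * (a - b))) *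
      μ ((fun i => Γ i a) '' A)) (𝓝[>] 0)
      (𝓝 (ENNReal.ofReal (Real.exp (-β)) * μ ((fun i => Γ i a) '' A))) := by
    -- The volume at time `a` may be infinite; the limit is legitimate because the other factor
    -- tends to `exp (-β) ≠ 0`.
    refine ENNReal.Tendsto.mul_const ?_ (Or.inl ?_)
    · have h1 : Continuous fun ε : ℝ => ENNReal.ofReal (Real.exp (-β + ε * (a - b))) := by
        exact ENNReal.continuous_ofReal.comp (by fun_prop)
      have h2 := h1.tendsto 0
      simp only [zero_mul, add_zero] at h2
      exact h2.mono_left nhdsWithin_le_nhds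
    · simpa using Real.exp_pos _
  exact ge_of_tendsto hlim (eventually_of_mem self_mem_nhdsWithin fun ε h => hε ε h)

end GlobalEstimate

/-! ### Counting volume over spanning sets. -/

namespace ControlSystem

variable {d m : ℕ} {M : Type*} [TopologicalSpace M]
  [ChartedSpace (EuclideanSpace ℝ (Fin d)) M] [IsManifold (𝓡 d) ∞ M]

lemma isTrajectory_φ (Sys : ControlSystem d m M) (x : M) (w : Controls Sys.U) :
    IsTrajectory Sys.F w x (fun t => Sys.φ t x w) :=
  (Sys.existsUnique_trajectory x w).choose_spec.1

lemma Admissible.exists_stayingPair {Sys : ControlSystem d m M} {K Q : Set M}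
    (h : Sys.Admissible K Q) (τ : ℝ) : (Sys.stayingPairs K Q τ).Nonempty := by
  obtain ⟨x, hx⟩ := h.nonempty_left
  obtain ⟨w, hw⟩ := h.exists_control x hx
  exact ⟨(x, w), hx, fun s hs => hw s hs.1⟩

/-- A single point of `K` forces one admissible term into the sum. This is the bound used when the
divergence infimum is not positive. -/
lemma exp_le_tsum_of_spanning {Sys : ControlSystem d m M} {K Q : Set M} (hK : K.Nonempty)
    {τ : ℝ} {f : EuclideanSpace ℝ (Fin m) → ℝ} {S : Set (Controls Sys.U)}
    (hS : Sys.Spanning τ K Q S) {α : ℝ}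
    (hα : ∀ q ∈ Sys.stayingPairs K Q τ, α ≤ Sys.potentialSum f τ q.2) :
    ENNReal.ofReal (Real.exp α) ≤
      ∑' w : S, ENNReal.ofReal (Real.exp (Sys.potentialSum f τ w)) := by
  obtain ⟨x, hx⟩ := hK
  obtain ⟨w, hw, hwQ⟩ := hS x hx
  refine le_trans ?_ (ENNReal.le_tsum (⟨w, hw⟩ : S))
  exact ENNReal.ofReal_le_ofReal (Real.exp_le_exp.2 (hα (x, w) ⟨hx, hwQ⟩))

/-- The volume estimate for spanning sets. -/
lemma volume_mul_exp_le_of_spanning [T2Space M] [SecondCountableTopology M] [MeasurableSpace M]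
    [BorelSpace M] (g : Metric d M) {Sys : ControlSystem d m M} {K Q : Set M}
    (hQ : riemannianVolume g Q ≠ 0) {τ : ℝ} (hτ : 0 ≤ τ) {f : EuclideanSpace ℝ (Fin m) → ℝ}
    {S : Set (Controls Sys.U)} (hS : Sys.Spanning τ K Q S) {α β : ℝ}
    (hα : ∀ q ∈ Sys.stayingPairs K Q τ, α ≤ Sys.potentialSum f τ q.2)
    (hβ : ∀ q ∈ Sys.stayingPairs K Q τ, β ≤ Sys.divergenceIntegral g τ q.1 q.2) :
    riemannianVolume g K * ENNReal.ofReal (Real.exp (α + β)) ≤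
      riemannianVolume g Q * ∑' w : S, ENNReal.ofReal (Real.exp (Sys.potentialSum f τ w)) := by
  set μ := riemannianVolume g
  by_cases htop : ∑' w : S, ENNReal.ofReal (Real.exp (Sys.potentialSum f τ w)) = ⊤
  · rw [htop, ENNReal.mul_top hQ]
    exact le_top
  -- A finite sum of strictly positive terms has countably many of them, as countable subadditivity
  -- over the cover requires.
  have hcount : Countable S := by
    have h1 := Summable.countable_support_ennreal htop
    have h2 : Function.support (fun w : S =>
        ENNReal.ofReal (Real.exp (Sys.potentialSum f τ w))) = univ := by
      ext w
      simp [Real.exp_pos]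
    rw [h2] at h1
    exact countable_univ_iff.1 h1
  set A : S → Set M := fun w => {x ∈ K | ∀ t ∈ Icc 0 τ, Sys.φ t x w ∈ Q}
  have hKA : K ⊆ ⋃ w, A w := by
    intro x hx
    obtain ⟨w, hw, hwQ⟩ := hS x hx
    exact mem_iUnion.2 ⟨⟨w, hw⟩, hx, hwQ⟩
  have hpiece : ∀ w : S, μ (A w) * ENNReal.ofReal (Real.exp (α + β)) ≤
      μ Q * ENNReal.ofReal (Real.exp (Sys.potentialSum f τ w)) := by
    intro w
    -- The bound `α` is known only for staying pairs, so a point of `A w` is needed to apply it to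
    -- `w`.
    rcases (A w).eq_empty_or_nonempty with he | ⟨x₀, hx₀⟩
    · simp [he]
    have h1 := riemannianVolume_image_le g Sys.contMDiff_F Sys.isCompact_U w.1.2.1 w.1.2.2
      (Γ := fun x t => Sys.φ t x w) (fun x => Sys.isTrajectory_φ x w) hτ (A := A w) (β := β)
      fun x hx => hβ (x, w) hx
    have h2 : (fun x => Sys.φ 0 x w) '' A w = A w := by
      have : ∀ x, Sys.φ 0 x w = x := fun x => (Sys.isTrajectory_φ x w).init
      simp [this]
    rw [h2] at h1
    have h3 : (fun x => Sys.φ τ x w) '' A w ⊆ Q := by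
      rintro _ ⟨x, hx, rfl⟩
      exact hx.2 τ ⟨hτ, le_rfl⟩
    calc μ (A w) * ENNReal.ofReal (Real.exp (α + β))
        ≤ (ENNReal.ofReal (Real.exp (-β)) * μ Q) * ENNReal.ofReal (Real.exp (α + β)) := by
          refine mul_le_mul' (h1.trans (mul_le_mul' le_rfl (measure_mono h3))) le_rfl
      _ = μ Q * ENNReal.ofReal (Real.exp α) := by
          rw [mul_comm (ENNReal.ofReal _) (μ Q), mul_assoc,
            ← ENNReal.ofReal_mul (Real.exp_pos _).le, ← Real.exp_add]
          congr 3
          ring_nf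
      _ ≤ _ := mul_le_mul' le_rfl
          (ENNReal.ofReal_le_ofReal (Real.exp_le_exp.2 (hα (x₀, w) hx₀)))
  calc μ K * ENNReal.ofReal (Real.exp (α + β))
      ≤ (∑' w, μ (A w)) * ENNReal.ofReal (Real.exp (α + β)) :=
        mul_le_mul' ((measure_mono hKA).trans (measure_iUnion_le _)) le_rfl
    _ = ∑' w, μ (A w) * ENNReal.ofReal (Real.exp (α + β)) := ENNReal.tsum_mul_right.symm
    _ ≤ ∑' w : S, μ Q * ENNReal.ofReal (Real.exp (Sys.potentialSum f τ w)) :=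
        ENNReal.tsum_le_tsum hpiece
    _ = _ := ENNReal.tsum_mul_left

lemma le_log_aInv {Sys : ControlSystem d m M} {K Q : Set M} {τ y : ℝ}
    {f : EuclideanSpace ℝ (Fin m) → ℝ}
    (h : ∀ S, Sys.Spanning τ K Q S → ENNReal.ofReal (Real.exp y) ≤
      ∑' w : S, ENNReal.ofReal (Real.exp (Sys.potentialSum f τ w))) :
    (y : EReal) ≤ ENNReal.log (Sys.aInv f K Q τ) := by
  have h1 : ENNReal.ofReal (Real.exp y) ≤ Sys.aInv f K Q τ := le_iInf₂ h
  have h2 := ENNReal.log_le_log h1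
  rwa [ENNReal.log_ofReal_of_pos (Real.exp_pos y), Real.log_exp] at h2

/-- The estimate of `a_τ(f, K, Q)` from below, up to a factor independent of `τ`. -/
lemma exists_add_max_le_log_aInv [T2Space M] [SecondCountableTopology M] [MeasurableSpace M]
    [BorelSpace M] (g : Metric d M) {Sys : ControlSystem d m M} {K Q : Set M}
    (hKQ : Sys.Admissible K Q) (hK_pos : 0 < riemannianVolume g K)
    (hK_fin : riemannianVolume g K < ⊤) (hQ_pos : 0 < riemannianVolume g Q)
    (hQ_fin : riemannianVolume g Q < ⊤) (f : EuclideanSpace ℝ (Fin m) → ℝ) :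
    ∃ c : ℝ, ∀ τ : ℝ, 0 ≤ τ →
      (⨅ p ∈ Sys.stayingPairs K Q τ, (Sys.potentialSum f τ p.2 : EReal)) +
        max 0 (⨅ p ∈ Sys.stayingPairs K Q τ, (Sys.divergenceIntegral g τ p.1 p.2 : EReal)) ≤
      ENNReal.log (Sys.aInv f K Q τ) + (c : EReal) := by
  set k := (riemannianVolume g K).toReal with hk
  set q := (riemannianVolume g Q).toReal with hq
  have hk0 : 0 < k := ENNReal.toReal_pos hK_pos.ne' hK_fin.ne
  have hq0 : 0 < q := ENNReal.toReal_pos hQ_pos.ne' hQ_fin.ne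
  have hkK : riemannianVolume g K = ENNReal.ofReal k := (ENNReal.ofReal_toReal hK_fin.ne).symm
  have hqQ : riemannianVolume g Q = ENNReal.ofReal q := (ENNReal.ofReal_toReal hQ_fin.ne).symm
  -- The logarithm of the volume ratio is what the volume count loses; the maximum with `0` makes
  -- the same constant valid for the one-term bound.
  set c := max 0 (Real.log (q / k)) with hc
  refine ⟨c, fun τ hτ => ?_⟩
  set αE := ⨅ p ∈ Sys.stayingPairs K Q τ, (Sys.potentialSum f τ p.2 : EReal) with hαE
  set βE := ⨅ p ∈ Sys.stayingPairs K Q τ, (Sys.divergenceIntegral g τ p.1 p.2 : EReal) with hβE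
  obtain ⟨p₀, hp₀⟩ := hKQ.exists_stayingPair τ
  have hα_le : ∀ p ∈ Sys.stayingPairs K Q τ, αE ≤ (Sys.potentialSum f τ p.2 : EReal) :=
    fun p hp => iInf₂_le p hp
  have hβ_le : ∀ p ∈ Sys.stayingPairs K Q τ, βE ≤ (Sys.divergenceIntegral g τ p.1 p.2 : EReal) :=
    fun p hp => iInf₂_le p hp
  have hα_top : αE ≠ ⊤ := ne_top_of_le_ne_top (EReal.coe_ne_top _) (hα_le p₀ hp₀)
  have hβ_top : βE ≠ ⊤ := ne_top_of_le_ne_top (EReal.coe_ne_top _) (hβ_le p₀ hp₀)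
  clear_value αE βE
  have hsub : ∀ y : ℝ, ((y - c : ℝ) : EReal) ≤ ENNReal.log (Sys.aInv f K Q τ) →
      (y : EReal) ≤ ENNReal.log (Sys.aInv f K Q τ) + (c : EReal) := by
    intro y hy
    have := add_le_add_left hy (c : EReal)
    rwa [← EReal.coe_add, sub_add_cancel] at this
  induction αE with
  | bot => simp
  | top => exact absurd rfl hα_top
  | coe α =>
    have hα : ∀ p ∈ Sys.stayingPairs K Q τ, α ≤ Sys.potentialSum f τ p.2 :=
      fun p hp => EReal.coe_le_coe_iff.1 (hα_le p hp)
    have hzero : (α : EReal) ≤ ENNReal.log (Sys.aInv f K Q τ) + (c : EReal) := by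
      refine hsub α (le_log_aInv fun S hS => le_trans ?_
        (exp_le_tsum_of_spanning hKQ.nonempty_left hS hα))
      refine ENNReal.ofReal_le_ofReal (Real.exp_le_exp.2 ?_)
      linarith [le_max_left 0 (Real.log (q / k))]
    rcases le_total βE 0 with hβ0 | hβ0
    · rw [max_eq_left hβ0, add_zero]
      exact hzero
    · rw [max_eq_right hβ0]
      induction βE with
      | bot => simp at hβ0
      | top => exact absurd rfl hβ_top
      | coe β =>
        have hβ : ∀ p ∈ Sys.stayingPairs K Q τ, β ≤ Sys.divergenceIntegral g τ p.1 p.2 :=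
          fun p hp => EReal.coe_le_coe_iff.1 (hβ_le p hp)
        rw [← EReal.coe_add]
        refine hsub (α + β) (le_log_aInv fun S hS => ?_)
        have h1 := volume_mul_exp_le_of_spanning g hQ_pos.ne' hτ hS hα hβ
        refine (ENNReal.mul_le_mul_iff_right hQ_pos.ne' hQ_fin.ne).1 (le_trans ?_ h1)
        rw [hkK, hqQ, ← ENNReal.ofReal_mul hk0.le, ← ENNReal.ofReal_mul hq0.le]
        refine ENNReal.ofReal_le_ofReal ?_
        have h2 : q / k ≤ Real.exp c := by
          rw [← Real.log_le_iff_le_exp (by positivity)]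
          exact le_max_right _ _
        rw [div_le_iff₀ hk0] at h2
        rw [Real.exp_sub, ← mul_div_assoc, div_le_iff₀ (Real.exp_pos c)]
        nlinarith [Real.exp_pos (α + β)]

end ControlSystem

end InvPressure

/-! ### Passage to the limit superior. -/

theorem mainTheorem2 {d m : ℕ} {M : Type*} [TopologicalSpace M] [T2Space M]
    [SecondCountableTopology M] [ConnectedSpace M]
    [ChartedSpace (EuclideanSpace ℝ (Fin d)) M] [IsManifold (𝓡 d) ∞ M]
    [MeasurableSpace M] [BorelSpace M]
    (g : InvPressure.Metric d M) (Sys : InvPressure.ControlSystem d m M)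
    (K Q : Set M) (hKQ : Sys.Admissible K Q)
    (hK_pos : 0 < InvPressure.riemannianVolume g K)
    (hK_fin : InvPressure.riemannianVolume g K < ⊤)
    (hQ_pos : 0 < InvPressure.riemannianVolume g Q)
    (hQ_fin : InvPressure.riemannianVolume g Q < ⊤)
    (f : EuclideanSpace ℝ (Fin m) → ℝ) (hf : ContinuousOn f Sys.U) :
    limsup (fun τ : ℝ => ((τ⁻¹ : ℝ) : EReal) *
        ((⨅ p ∈ Sys.stayingPairs K Q τ, (Sys.potentialSum f τ p.2 : EReal)) +
          max 0 (⨅ p ∈ Sys.stayingPairs K Q τ,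
            (Sys.divergenceIntegral g τ p.1 p.2 : EReal)))) atTop
      ≤ Sys.invariancePressure f K Q := by
  obtain ⟨c, hc⟩ := InvPressure.ControlSystem.exists_add_max_le_log_aInv g hKQ hK_pos hK_fin
    hQ_pos hQ_fin f
  have hlim : Tendsto (fun τ : ℝ => ((τ⁻¹ * c : ℝ) : EReal)) atTop (𝓝 0) := by
    have h1 : Tendsto (fun τ : ℝ => τ⁻¹ * c) atTop (𝓝 0) := by
      simpa using tendsto_inv_atTop_zero.mul_const c
    exact EReal.tendsto_coe.2 h1
  have hle : ∀ᶠ τ : ℝ in atTop, ((τ⁻¹ : ℝ) : EReal) *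
        ((⨅ p ∈ Sys.stayingPairs K Q τ, (Sys.potentialSum f τ p.2 : EReal)) +
          max 0 (⨅ p ∈ Sys.stayingPairs K Q τ,
            (Sys.divergenceIntegral g τ p.1 p.2 : EReal))) ≤
      ((τ⁻¹ : ℝ) : EReal) * ENNReal.log (Sys.aInv f K Q τ) + ((τ⁻¹ * c : ℝ) : EReal) := by
    filter_upwards [eventually_gt_atTop 0] with τ hτ
    have hτ' : (0 : EReal) ≤ ((τ⁻¹ : ℝ) : EReal) := EReal.coe_nonneg.2 (inv_pos.2 hτ).le
    refine (mul_le_mul_of_nonneg_left (hc τ hτ.le) hτ').trans ?_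
    rw [EReal.left_distrib_of_nonneg_of_ne_top hτ' (EReal.coe_ne_top _), EReal.coe_mul]
  refine (limsup_le_limsup hle).trans ?_
  -- Subadditivity in `EReal` must exclude `∞ - ∞`; the second summand `τ⁻¹ * c` has the finite
  -- limit `0`.
  refine (EReal.limsup_add_le (Or.inr ?_) (Or.inr ?_)).trans ?_
  · rw [hlim.limsup_eq]; exact EReal.zero_ne_top
  · rw [hlim.limsup_eq]; exact EReal.zero_ne_bot
  · rw [hlim.limsup_eq, add_zero]
    exact le_rfl
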